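/- \textbf{Setting.} Let $\mathcal X$ be a measurable space, let $\mathcal Y$ be a set of two labels, and let $\mathcal H$ be a class of measurable classifiers $h:\mathcal X\to\mathcal Y$ with $|\mathcal H|\ge 3$ and finite VC dimension $V$. For a distribution $P$ on $\mathcal X\times\mathcal Y$ put $R_P(h)=P(h(X)\ne Y)$ and $\mathcal E_P(h)=R_P(h)-\inf_{h'\in\mathcal H}R_P(h')$. Write $\log x=\max\{\ln x,1\}$, and use the conventions $0^0=1$ and $1/\infty=0$. A multisource class $\mathcal M$ has parameters $N$, $C_\rho\ge2$, $C_\beta\ge2$, $\beta\in[0,1]$, $\rho_1,\dots,\rho_N\in(0,\infty]$, sample sizes $n_1,\dots,n_N\ge1$ of the sources and $n_{N+1}\ge0$ of the target. It consists of the product laws $\Pi=\prod_{t=1}^{N+1}P_t^{n_t}$, with target $D=P_{N+1}$, such that (A1) some $h^*\in\mathcal H$ minimizes $R_{P_t}$ over $\mathcal H$ for every $t\in[N+1]$; (A2) $\mathcal E_D(h)\le C_\rho\,\mathcal E_{P_t}(h)^{1/\rho_t}$ for all $h\in\mathcal H$ and $t\in[N]$; (A3) for every $t\in[N+1]$, $P_t(h\ne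 h^*_t)\le C_\beta\,\mathcal E_{P_t}(h)^\beta$ for all $h\in\mathcal H$ and every minimizer $h^*_t$ of $R_{P_t}$ over $\mathcal H$. Put $\rho_{N+1}=1$. Order the tasks so that $\rho_{(1)}\le\dots\le\rho_{(N+1)}$, with ties broken arbitrarily, and for $t\in[N+1]$ let $$m_t=\sum_{s\le t}n_{(s)},\qquad \bar\rho_t=\sum_{s\le t}\frac{n_{(s)}}{m_t}\,\rho_{(s)},\qquad e_t=\frac1{(2-\beta)\bar\rho_t}.$$ In each minimum over $t$ below, terms with $m_t=0$ count as $+\infty$. A learner is a map $\hat h$ from multisamples $Z=(Z_t)_{t\in[N+1]}$, $Z\in\prod_t(\mathcal X\times\mathcal Y)^{n_t}$, to $\mathcal H$; it is measurable if $(Z,x)\mapsto\hat h(Z)(x)$ is. \textbf{Theorem.} There are numerical constants $c,C,c_1,c_2,C_0>0$ such that for all $\mathcal X,\mathcal H$ and all admissible parameters of $\mathcal M$ the following hold. 1. (Minimax rate.) Let $\rho_t\ge1$ for all $t\in[N]$ and $\sum_t n_t>0$. With the infimum taken over all measurable learners (which may depend on $\mathcal M$), $$c\,\min_{t\in[N+1]}\frac{m_t^{-e_t}}{\log^2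 m_t}\ \le\ \inf_{\hat h}\sup_{\Pi\in\mathcal M}\mathbb E_\Pi\big[\mathcal E_D(\hat h)\big]\ \le\ C\,C_\rho C_\beta V\,\min_{t\in[N+1]}m_t^{-e_t}\log m_t .$$ Hence the minimax risk is $\min_t m_t^{-1/((2-\beta)\bar\rho_t)}$ up to constants depending only on $C_\rho,C_\beta,V$ and logarithmic factors. For the upper inequality it is assumed that for every sample size there is a measurable empirical risk minimization rule over $\mathcal H$, i.e. one that is jointly measurable in the sample and the evaluation point. 2. (Lower bound.) Let $\rho_t\ge1$ for all $t\in[N]$. For every learner $\hat h$ there is $\Pi\in\mathcal M$ such that, with $\Pi$-probability at least $1/50$, $$\mathcal E_D(\hat h)>c_1\min\Big\{1,\ \min_{t\in[N+1]}\Big(\frac{c_2V}{m_t\log^2m_t}\Big)^{e_t}\Big\}.$$ (For a learner that is not measurable, probability means outer probability.) 3. (Upper bound.) Let $\rho_t\in(0,\infty]$ be arbitrary and $\delta\in(0,1)$. Put $$B_t=C_\rho\Big(C_0C_\beta\,\frac{V\log(m_t/V)+\log(1/\delta)}{m_t}\Big)^{e_t},$$ let $t^*$ minimize $B_t$ over $t\in[N+1]$,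 and let $\hat h$ be any measurable learner that returns a minimizer over $\mathcal H$ of the empirical risk on the union of $Z_{(1)},\dots,Z_{(t^*)}$. Then for every $\Pi\in\mathcal M$, with $\Pi$-probability at least $1-\delta$, $$\mathcal E_D(\hat h)\le\min_{t\in[N+1]}B_t .$$ -/

import Mathlib

open MeasureTheory
open scoped ENNReal

universe u

noncomputable section

namespace Multisource

/-! Labels are encoded by `Bool` (a two-element label set). -/

/-- A classifier on `X`. -/
abbrev Classifier (X : Type u) := X → Bool

section Classification

variable {X : Type u}

/-- A finite set `S` of points is shattered by `H`: every labelling of `S` is realized in `H`. -/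
def Shattered (H : Set (Classifier X)) (S : Finset X) : Prop :=
  ∀ y : X → Bool, ∃ h ∈ H, ∀ x ∈ S, h x = y x

/-- `H` has (finite) VC dimension exactly `V`. -/
def HasVCDim (H : Set (Classifier X)) (V : ℕ) : Prop :=
  (∃ S : Finset X, S.card = V ∧ Shattered H S) ∧
    ∀ S : Finset X, Shattered H S → S.card ≤ V

variable [MeasurableSpace X]

/-- The 0-1 risk `R_P(h) = P(h(X) ≠ Y)`. -/
def risk (P : Measure (X × Bool)) (h : Classifier X) : ℝ :=
  P.real {z | h z.1 ≠ z.2}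

/-- The excess risk over the best in class, `R_P(h) - inf_{h' ∈ H} R_P(h')`. -/
def excessRisk (H : Set (Classifier X)) (P : Measure (X × Bool)) (h : Classifier X) : ℝ :=
  risk P h - ⨅ h' : H, risk P h'.1

/-- The pseudo-distance `P(h ≠ h') = P_X(h(X) ≠ h'(X))`. -/
def disagreement (P : Measure (X × Bool)) (h h' : Classifier X) : ℝ :=
  P.real {z | h z.1 ≠ h' z.1}

/-- `h` is a best-in-class classifier for `P`. -/
def IsBest (H : Set (Classifier X)) (P : Measure (X × Bool)) (h : Classifier X) : Prop :=
  h ∈ H ∧ ∀ h' ∈ H, risk P h ≤ risk P h'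

/-- The Bernstein class condition with parameters `(Cβ, β)`. As usual `0 ^ 0 = 1`. -/
def BernsteinClass (H : Set (Classifier X)) (P : Measure (X × Bool)) (Cβ β : ℝ) : Prop :=
  ∀ hstar, IsBest H P hstar →
    ∀ h ∈ H, disagreement P h hstar ≤ Cβ * excessRisk H P h ^ β

/-- `P` has transfer exponent `(Cρ, ρ)` with respect to `D`. For `ρ = ∞` the power `1/ρ` is `0`,
and `0 ^ 0 = 1`. -/
def TransferExponent (H : Set (Classifier X)) (P D : Measure (X × Bool))
    (Cρ : ℝ) (ρ : ℝ≥0∞) : Prop :=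
  ∀ h ∈ H, excessRisk H D h ≤ Cρ * excessRisk H P h ^ (ρ⁻¹).toReal

/-- Empirical risk minimization over `H` can be carried out measurably, for every sample size:
there is a map that sends each sample to an empirical risk minimizer in `H` and is jointly
measurable in the sample and the point at which the returned classifier is evaluated. -/
def AdmitsMeasurableERM (H : Set (Classifier X)) : Prop :=
  ∀ m : ℕ, ∃ A : (Fin m → X × Bool) → Classifier X,
    (∀ S, A S ∈ H) ∧ (Measurable fun p : (Fin m → X × Bool) × X => A p.1 p.2) ∧
      ∀ S, ∀ h ∈ H,
        (∑ i, if A S (S i).1 ≠ (S i).2 then (1 : ℝ) else 0) ≤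
          ∑ i, if h (S i).1 ≠ (S i).2 then (1 : ℝ) else 0

end Classification

/-- Admissible parameters of a multisource class with `N` sources. The tasks are indexed by
`Fin (N + 1)`; the last index is the target. -/
structure Params (N : ℕ) where
  /-- transfer exponents of the sources, possibly infinite -/
  ρ : Fin N → ℝ≥0∞
  /-- sample sizes of the sources and (last) of the target -/
  n : Fin (N + 1) → ℕ
  /-- constant of the transfer exponents -/
  Cρ : ℝ
  /-- constant of the Bernstein class condition -/
  Cβ : ℝ
  /-- exponent of the Bernstein class condition -/
  β : ℝ
  ρ_pos : ∀ t, 0 < ρ t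
  n_pos : ∀ t : Fin N, 1 ≤ n t.castSucc
  two_le_Cρ : 2 ≤ Cρ
  two_le_Cβ : 2 ≤ Cβ
  β_nonneg : 0 ≤ β
  β_le_one : β ≤ 1

/-- Multisamples: one sample of size `n t` for each task `t`. -/
abbrev MultiSample (X : Type u) {N : ℕ} (n : Fin (N + 1) → ℕ) :=
  (t : Fin (N + 1)) → Fin (n t) → X × Bool

section Samples

variable {X : Type u} {N : ℕ}

/-- The empirical risk on the union of the samples with index in `I` (`0` if it is empty). -/
def empRisk {n : Fin (N + 1) → ℕ} (z : MultiSample X n) (I : Finset (Fin (N + 1)))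
    (h : Classifier X) : ℝ :=
  (∑ s ∈ I, ∑ i, if h (z s i).1 ≠ (z s i).2 then (1 : ℝ) else 0) / (∑ s ∈ I, n s : ℕ)

/-- `A` is a multisource learner: a map from multisamples to `H`. -/
def IsLearner (H : Set (Classifier X)) {n : Fin (N + 1) → ℕ}
    (A : MultiSample X n → Classifier X) : Prop :=
  ∀ z, A z ∈ H

/-- The learner `A` returns an empirical risk minimizer on the union of the samples in `I`. -/
def IsERM (H : Set (Classifier X)) {n : Fin (N + 1) → ℕ} (I : Finset (Fin (N + 1)))
    (A : MultiSample X n → Classifier X) : Prop :=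
  IsLearner H A ∧ ∀ z, ∀ h ∈ H, empRisk z I (A z) ≤ empRisk z I h

variable [MeasurableSpace X]

/-- Joint measurability of `(z, x) ↦ A(z)(x)`. -/
def MeasurableLearner {n : Fin (N + 1) → ℕ} (A : MultiSample X n → Classifier X) : Prop :=
  Measurable fun p : MultiSample X n × X => A p.1 p.2

/-- The law `Π = ∏ₜ Pₜ^{nₜ}` of the multisample. -/
def sampleLaw (n : Fin (N + 1) → ℕ) (P : Fin (N + 1) → Measure (X × Bool)) :
    Measure (MultiSample X n) :=
  Measure.pi fun t => Measure.pi fun _ : Fin (n t) => P t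

end Samples

namespace Params

variable {N : ℕ} (M : Params N)

/-- All transfer exponents, with the target's own exponent `1` last. -/
def exponent : Fin (N + 1) → ℝ≥0∞ := Fin.snoc (α := fun _ => ℝ≥0∞) M.ρ 1

/-- The multisource class: tuples `(P₁, …, P_N, D)` of distributions that share a best-in-class
classifier, whose sources have the given transfer exponents to the target, and that all satisfy the
Bernstein class condition. -/
structure Mem {X : Type u} [MeasurableSpace X] (H : Set (Classifier X))
    (P : Fin (N + 1) → Measure (X × Bool)) : Prop where
  prob : ∀ t, IsProbabilityMeasure (P t)
  common_best : ∃ hstar, ∀ t, IsBest H (P t) hstar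
  transfer : ∀ t : Fin N,
    TransferExponent H (P t.castSucc) (P (Fin.last N)) M.Cρ (M.ρ t)
  bernstein : ∀ t, BernsteinClass H (P t) M.Cβ M.β

/-- `σ` ranks the tasks by transfer exponent: `σ s` is the task usually written `(s)`. -/
def IsRanking (σ : Equiv.Perm (Fin (N + 1))) : Prop :=
  Monotone fun s => M.exponent (σ s)

/-- The tasks `{(1), …, (t)}`. -/
def prefixSet (σ : Equiv.Perm (Fin (N + 1))) (t : Fin (N + 1)) : Finset (Fin (N + 1)) :=
  (Finset.Iic t).map σ.toEmbedding

/-- The pooled sample size `n_(1) + … + n_(t)`. -/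
def prefixSize (σ : Equiv.Perm (Fin (N + 1))) (t : Fin (N + 1)) : ℕ :=
  ∑ s ∈ Finset.Iic t, M.n (σ s)

/-- The average transfer exponent `ρ̄_t` of the first `t` tasks, weighted by sample size. -/
def avgExponent (σ : Equiv.Perm (Fin (N + 1))) (t : Fin (N + 1)) : ℝ≥0∞ :=
  (∑ s ∈ Finset.Iic t, (M.n (σ s) : ℝ≥0∞) * M.exponent (σ s)) / (M.prefixSize σ t : ℝ≥0∞)

/-- The power `1 / ((2 - β) ρ̄_t)`, which is `0` if `ρ̄_t = ∞`. -/
def ratePower (σ : Equiv.Perm (Fin (N + 1))) (t : Fin (N + 1)) : ℝ :=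
  1 / (2 - M.β) * ((M.avgExponent σ t)⁻¹).toReal

/-- The minimax expected excess risk on the target: the infimum over measurable learners of the
supremum over the class. -/
def minimaxRisk {X : Type u} [MeasurableSpace X] (H : Set (Classifier X)) : ℝ≥0∞ :=
  ⨅ A : {A : MultiSample X M.n → Classifier X // IsLearner H A ∧ MeasurableLearner A},
    ⨆ P : {P : Fin (N + 1) → Measure (X × Bool) // M.Mem H P},
      ∫⁻ z, ENNReal.ofReal (excessRisk H (P.1 (Fin.last N)) (A.1 z)) ∂(sampleLaw M.n P.1)

end Params

/-- The positive logarithm `max (ln x) 1`. -/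
def posLog (x : ℝ) : ℝ := max (Real.log x) 1

/-- A function `f` of the sample size, with the convention that the value is `∞` for the
empty sample. -/
def orTop (m : ℕ) (f : ℝ → ℝ) : ℝ≥0∞ := if m = 0 then ∞ else ENNReal.ofReal (f m)

namespace Params

variable {N : ℕ} (M : Params N)

/-- `m ^ (-1 / ((2 - β) ρ̄_t)) / log² m` for `m = n_(1) + … + n_(t)`. -/
def minimaxLowerTerm (σ : Equiv.Perm (Fin (N + 1))) (t : Fin (N + 1)) : ℝ≥0∞ :=
  orTop (M.prefixSize σ t) fun m => m ^ (-M.ratePower σ t) / posLog m ^ 2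

/-- `m ^ (-1 / ((2 - β) ρ̄_t)) * log m` for `m = n_(1) + … + n_(t)`. -/
def minimaxUpperTerm (σ : Equiv.Perm (Fin (N + 1))) (t : Fin (N + 1)) : ℝ≥0∞ :=
  orTop (M.prefixSize σ t) fun m => m ^ (-M.ratePower σ t) * posLog m

/-- `(c V / (m log² m)) ^ (1 / ((2 - β) ρ̄_t))` for `m = n_(1) + … + n_(t)`. -/
def lowerTerm (c : ℝ) (V : ℕ) (σ : Equiv.Perm (Fin (N + 1))) (t : Fin (N + 1)) : ℝ≥0∞ :=
  orTop (M.prefixSize σ t) fun m => (c * V / (m * posLog m ^ 2)) ^ M.ratePower σ t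

/-- `Cρ (c Cβ (V log (m / V) + log (1 / δ)) / m) ^ (1 / ((2 - β) ρ̄_t))`
for `m = n_(1) + … + n_(t)`. -/
def upperTerm (c : ℝ) (V : ℕ) (δ : ℝ) (σ : Equiv.Perm (Fin (N + 1))) (t : Fin (N + 1)) : ℝ≥0∞ :=
  orTop (M.prefixSize σ t) fun m =>
    M.Cρ * (c * M.Cβ * ((V * posLog (m / V) + posLog (1 / δ)) / m)) ^ M.ratePower σ t

end Params

end Multisource

end

/-! Lower bound. Some `k ≥ V / 2` points carry all labellings, realized by classifiers that agree at
one further anchor point. Given a scale `ε ≤ 1`, a task of finite exponent `ρ` puts mass `ε ^ (ρβ) /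
2` on these points, with label margin `ε ^ (ρ(1 - β)) / 2`, and the rest on the anchor. Mislabelling
all hard points then costs `ε ^ ρ / 4`, which is compatible with both the transfer and the Bernstein
conditions, while one observation lowers the affinity of two neighbouring labellings by at most `ε ^
((2 - β)ρ) / (8k)`. Assouad's lemma defeats every learner at scale `ε` as soon as `∑ n_t ε ^ ((2 -
β)ρ_t) ≤ 4k` (`exists_mem_of_information_le`).

Suppose `ε ≤ (V / (4 m_t log² m_t)) ^ e_t` for all `t`. Since the tasks are sorted, `ρ̄_t ≤ ρ_(t)`,
so that `ε ^ ((2 - β)ρ_(t)) ≤ V / (4 m_t log² m_t)`. The sum of `n_(t) / (m_t log² m_t)` is like a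
Riemann sum of `dx / (x log² x)` and is bounded by a numerical constant, however many tasks there
are (`sum_div_mul_sq_posLog_le`). This is the origin of the squared logarithm.

Upper bound. The pooled sample of a prefix consists of independent, not identically distributed
observations. By Jensen's inequality the Bernstein condition passes to averages over the pool
(`Params.Mem.pooled_disagreement_le`), and a localized ghost-sample argument (`prob_excess_gt_le`)
bounds the average excess risk of the empirical risk minimizer by `b ^ (1 / (2 - β))`, where `b` is
of order `Cβ (V log (m / V) + log (1 / δ)) / m`. If `y` is the target excess risk divided by `Cρ`,
transfer gives `y ^ ρ_s ≤ 𝓔_s`, and the weighted AM-GM inequality gives `y ^ ρ̄ ≤ ∑ w_s y ^ ρ_s ≤ ∑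
w_s 𝓔_s`. So the average exponent governs the rate (`Params.Mem.excessRisk_target_le`). The choice
`δ = 1 / (2m)` turns this into a bound in expectation. -/

namespace Multisource

/-! ### Two-point testing and Assouad's lemma on finite spaces. -/

section Assouad

/-- Le Cam's inequality between the Bhattacharyya affinity and the overlap of two laws. -/
theorem sq_sum_sqrt_mul_le_two_mul_sum_min {α : Type*} [Fintype α] {P Q : α → ℝ}
    (hP : ∀ a, 0 ≤ P a) (hQ : ∀ a, 0 ≤ Q a) (hP1 : ∑ a, P a = 1) (hQ1 : ∑ a, Q a = 1) :
    (∑ a, √(P a * Q a)) ^ 2 ≤ 2 * ∑ a, min (P a) (Q a) := by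
  have h1 : ∀ a, √(P a * Q a) = √(min (P a) (Q a)) * √(max (P a) (Q a)) := fun a => by
    rw [← Real.sqrt_mul (le_min (hP a) (hQ a)), min_mul_max]
  simp_rw [h1]
  refine (Finset.sum_mul_sq_le_sq_mul_sq _ _ _).trans ?_
  have h2 : ∑ a, √(min (P a) (Q a)) ^ 2 = ∑ a, min (P a) (Q a) :=
    Finset.sum_congr rfl fun a _ => Real.sq_sqrt (le_min (hP a) (hQ a))
  have h3 : ∑ a, √(max (P a) (Q a)) ^ 2 ≤ 2 := by
    calc ∑ a, √(max (P a) (Q a)) ^ 2 = ∑ a, max (P a) (Q a) :=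
          Finset.sum_congr rfl fun a _ => Real.sq_sqrt ((hP a).trans (le_max_left _ _))
      _ ≤ ∑ a, (P a + Q a) := Finset.sum_le_sum fun a _ =>
          max_le (by linarith [hQ a]) (by linarith [hP a])
      _ = 2 := by rw [Finset.sum_add_distrib, hP1, hQ1]; norm_num
  rw [h2, mul_comm]
  exact mul_le_mul_of_nonneg_right h3 (Finset.sum_nonneg fun a _ => le_min (hP a) (hQ a))

/-- Flip the `j`-th bit of a labelling. -/
def flipAt {κ : Type*} [DecidableEq κ] (j : κ) (s : κ → Bool) : κ → Bool := Function.update s j (!(s j))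

theorem flipAt_flipAt {κ : Type*} [DecidableEq κ] (j : κ) (s : κ → Bool) : flipAt j (flipAt j s) = s := by
  funext i
  by_cases h : i = j
  · subst h; simp [flipAt]
  · simp [flipAt, h]

/-- The number of disagreements of two labellings. -/
noncomputable def hammingCount {κ : Type*} [Fintype κ] (d s : κ → Bool) : ℝ := ∑ j, if d j ≠ s j then (1 : ℝ) else 0

/-- Assouad's lemma, in the form of a probability bound. -/
theorem exists_le_prob_hammingCount {κ : Type*} [Fintype κ] [DecidableEq κ] [Nonempty κ] {α : Type*} [Fintype α]
    (P : (κ → Bool) → α → ℝ) (hP : ∀ s a, 0 ≤ P s a) (hP1 : ∀ s, ∑ a, P s a = 1)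
    (haff : ∀ s j, 1 / 2 ≤ ∑ a, √(P s a * P (flipAt j s) a)) (d : α → κ → Bool) :
    ∃ s, 1 / 50 ≤
      ∑ a, if (Fintype.card κ : ℝ) / 50 < hammingCount (d a) s then P s a else 0 := by
  have hpair : ∀ j : κ, (Fintype.card (κ → Bool) : ℝ) * (1 / 16) ≤
      ∑ s, ∑ a, P s a * (if d a j ≠ s j then (1 : ℝ) else 0) := by
    intro j
    have e : ∑ s, ∑ a, P s a * (if d a j ≠ s j then (1 : ℝ) else 0) =
        ∑ s, ∑ a, P (flipAt j s) a * (if d a j ≠ flipAt j s j then (1 : ℝ) else 0) :=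
      (Equiv.sum_comp (Function.Involutive.toPerm (flipAt j) (flipAt_flipAt j))
        (fun s => ∑ a, P s a * (if d a j ≠ s j then (1 : ℝ) else 0))).symm
    -- Affinity at least `1 / 2` gives overlap at least `(1 / 2) ^ 2 / 2 = 1 / 8`. Every decision
    -- errs at `j` under exactly one of `s` and `flipAt j s`, so their error probabilities add up to
    -- at least the overlap.
    have h2 : ∀ s : κ → Bool, (1 / 8 : ℝ) ≤
        ∑ a, P s a * (if d a j ≠ s j then (1 : ℝ) else 0) +
        ∑ a, P (flipAt j s) a * (if d a j ≠ flipAt j s j then (1 : ℝ) else 0) := by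
      intro s
      have h3 := sq_sum_sqrt_mul_le_two_mul_sum_min (hP s) (hP (flipAt j s)) (hP1 s) (hP1 _)
      have h4 := haff s j
      have h5 : ∑ a, min (P s a) (P (flipAt j s) a) ≤
          ∑ a, P s a * (if d a j ≠ s j then (1 : ℝ) else 0) +
          ∑ a, P (flipAt j s) a * (if d a j ≠ flipAt j s j then (1 : ℝ) else 0) := by
        rw [← Finset.sum_add_distrib]
        refine Finset.sum_le_sum fun a _ => ?_
        have : flipAt j s j = !(s j) := by simp [flipAt]
        rw [this]
        cases h : d a j <;> cases h' : s j <;> simp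
      nlinarith
    have h6 : ∑ _s : κ → Bool, (1 / 8 : ℝ) ≤ _ := Finset.sum_le_sum fun s _ => h2 s
    rw [Finset.sum_add_distrib, ← e, Finset.sum_const, Finset.card_univ, nsmul_eq_mul] at h6
    linarith
  have htot : (Fintype.card (κ → Bool) : ℝ) * ((Fintype.card κ : ℝ) * (1 / 16)) ≤
      ∑ s, ∑ a, P s a * hammingCount (d a) s := by
    have h7 : ∑ _j : κ, (Fintype.card (κ → Bool) : ℝ) * (1 / 16) ≤ _ :=
      Finset.sum_le_sum fun j _ => hpair j
    rw [Finset.sum_const, Finset.card_univ, nsmul_eq_mul, Finset.sum_comm] at h7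
    have : ∀ s, ∑ a, P s a * hammingCount (d a) s =
        ∑ j, ∑ a, P s a * (if d a j ≠ s j then (1 : ℝ) else 0) := fun s => by
      rw [Finset.sum_comm]
      exact Finset.sum_congr rfl fun a _ => by rw [hammingCount, Finset.mul_sum]
    simp_rw [this]
    linarith
  have hk : (0 : ℝ) < Fintype.card κ := by exact_mod_cast Fintype.card_pos
  obtain ⟨s, -, hs⟩ : ∃ s ∈ (Finset.univ : Finset (κ → Bool)), (Fintype.card κ : ℝ) * (1 / 16) ≤
      ∑ a, P s a * hammingCount (d a) s := by
    apply Finset.exists_le_of_sum_le Finset.univ_nonempty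
    rw [Finset.sum_const, Finset.card_univ, nsmul_eq_mul]
    exact htot
  refine ⟨s, ?_⟩
  have hle : ∀ a, hammingCount (d a) s ≤ Fintype.card κ := fun a => by
    calc hammingCount (d a) s ≤ ∑ _j : κ, (1 : ℝ) :=
          Finset.sum_le_sum fun j _ => by split_ifs <;> norm_num
      _ = _ := by simp
  -- Reverse Markov inequality: the mean is at least `k / 16` and the count at most `k`, and `1 / 16
  -- - 1 / 50 > 1 / 50`.
  have h8 : ∑ a, P s a * hammingCount (d a) s ≤
      ∑ a, ((Fintype.card κ : ℝ) *
        (if (Fintype.card κ : ℝ) / 50 < hammingCount (d a) s then P s a else 0) +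
          (Fintype.card κ : ℝ) / 50 * P s a) := by
    refine Finset.sum_le_sum fun a _ => ?_
    split_ifs with h
    · nlinarith [hP s a, hle a, mul_nonneg hk.le (hP s a)]
    · nlinarith [hP s a]
  rw [Finset.sum_add_distrib, ← Finset.mul_sum, ← Finset.mul_sum, hP1] at h8
  have := hs.trans h8
  by_contra hcon
  push Not at hcon
  nlinarith

end Assouad

/-! ### Product laws: affinity and finitely supported measures. -/

section ProductLaw

/-- The weights of a product law on a finite multisample space. -/
def productWeight {N : ℕ} {n : Fin (N + 1) → ℕ} {Ω : Type*} (w : Fin (N + 1) → Ω → ℝ)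
    (a : (t : Fin (N + 1)) → Fin (n t) → Ω) : ℝ :=
  ∏ t, ∏ i, w t (a t i)

theorem sum_productWeight {N : ℕ} {n : Fin (N + 1) → ℕ} {Ω : Type*} [Fintype Ω]
    (w : Fin (N + 1) → Ω → ℝ) :
    ∑ a : (t : Fin (N + 1)) → Fin (n t) → Ω, productWeight w a = ∏ t, (∑ ω, w t ω) ^ n t := by
  classical
  unfold productWeight
  rw [← Fintype.prod_sum fun t (b : Fin (n t) → Ω) => ∏ i, w t (b i)]
  refine Finset.prod_congr rfl fun t _ => ?_
  rw [← Fintype.prod_sum fun (_ : Fin (n t)) (ω : Ω) => w t ω]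
  simp

theorem one_sub_sum_le_prod_one_sub {ι : Type*} (s : Finset ι) (u : ι → ℝ)
    (h0 : ∀ i ∈ s, 0 ≤ u i) (h1 : ∀ i ∈ s, u i ≤ 1) : 1 - ∑ i ∈ s, u i ≤ ∏ i ∈ s, (1 - u i) := by
  classical
  induction s using Finset.induction_on with
  | empty => simp
  | insert a s ha ih =>
    rw [Finset.sum_insert ha, Finset.prod_insert ha]
    have h2 := ih (fun i hi => h0 i (by simp [hi])) (fun i hi => h1 i (by simp [hi]))
    have h3 := h0 a (by simp)
    have h4 := h1 a (by simp)
    have h5 : 0 ≤ ∑ i ∈ s, u i := Finset.sum_nonneg fun i hi => h0 i (by simp [hi])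
    nlinarith

/-- The affinity is multiplicative over independent observations, so the defects `u t` add up by the
Weierstrass product inequality. -/
theorem one_sub_sum_le_affinity {N : ℕ} (n : Fin (N + 1) → ℕ) {Ω : Type*} [Fintype Ω]
    (w w' : Fin (N + 1) → Ω → ℝ) (hw : ∀ t ω, 0 ≤ w t ω) (hw' : ∀ t ω, 0 ≤ w' t ω)
    (u : Fin (N + 1) → ℝ) (hu0 : ∀ t, 0 ≤ u t) (hu1 : ∀ t, u t ≤ 1)
    (hu : ∀ t, 1 - u t ≤ ∑ ω, √(w t ω * w' t ω)) :
    1 - ∑ t, n t * u t ≤ ∑ a : (t : Fin (N + 1)) → Fin (n t) → Ω,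
      √(productWeight w a * productWeight w' a) := by
  have h1 : ∀ a : (t : Fin (N + 1)) → Fin (n t) → Ω,
      √(productWeight w a * productWeight w' a) =
        productWeight (fun t ω => √(w t ω * w' t ω)) a := by
    intro a
    unfold productWeight
    rw [← Finset.prod_mul_distrib, Real.sqrt_prod _ fun t _ => mul_nonneg
      (Finset.prod_nonneg fun i _ => hw _ _) (Finset.prod_nonneg fun i _ => hw' _ _)]
    refine Finset.prod_congr rfl fun t _ => ?_
    rw [← Finset.prod_mul_distrib, Real.sqrt_prod _ fun i _ => mul_nonneg (hw _ _) (hw' _ _)]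
  simp_rw [h1]
  rw [sum_productWeight]
  have h2 : ∀ t, (1 - u t) ^ n t ≤ (∑ ω, √(w t ω * w' t ω)) ^ n t := fun t =>
    pow_le_pow_left₀ (by linarith [hu1 t]) (hu t) _
  have h3 := one_sub_sum_le_prod_one_sub
    (Finset.univ.sigma fun t => (Finset.univ : Finset (Fin (n t)))) (fun p => u p.1)
    (fun p _ => hu0 p.1) (fun p _ => hu1 p.1)
  rw [Finset.sum_sigma, Finset.prod_sigma] at h3
  simp only [Finset.sum_const, Finset.prod_const, Finset.card_univ, Fintype.card_fin,
    nsmul_eq_mul] at h3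
  exact h3.trans (Finset.prod_le_prod (fun t _ => pow_nonneg (by linarith [hu1 t]) _)
    fun t _ => h2 t)

/-- The law of `g` under the weights `w` on a finite space. -/
noncomputable def discreteLaw {Ω Y : Type*} [Fintype Ω] [MeasurableSpace Y] (w : Ω → ℝ)
    (g : Ω → Y) : Measure Y :=
  ∑ ω, ENNReal.ofReal (w ω) • Measure.dirac (g ω)

variable {Ω Y : Type*} [Fintype Ω] [MeasurableSpace Y]

theorem discreteLaw_apply {w : Ω → ℝ} {g : Ω → Y} {S : Set Y} (hS : MeasurableSet S)
    [DecidablePred (· ∈ S)] :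
    discreteLaw w g S = ∑ ω, if g ω ∈ S then ENNReal.ofReal (w ω) else 0 := by
  simp only [discreteLaw, Measure.coe_finsetSum, Finset.sum_apply, Measure.smul_apply,
    Measure.dirac_apply' _ hS, smul_eq_mul, Set.indicator_apply, Pi.one_apply, mul_ite, mul_one,
    mul_zero]

theorem real_discreteLaw {w : Ω → ℝ} (hw : ∀ ω, 0 ≤ w ω) {g : Ω → Y} {S : Set Y}
    (hS : MeasurableSet S) [DecidablePred (· ∈ S)] :
    (discreteLaw w g).real S = ∑ ω, if g ω ∈ S then w ω else 0 := by
  rw [Measure.real, discreteLaw_apply hS, ENNReal.toReal_sum]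
  · refine Finset.sum_congr rfl fun ω _ => ?_
    split_ifs
    · exact ENNReal.toReal_ofReal (hw ω)
    · rfl
  · intro ω _
    split_ifs <;> simp

theorem isProbabilityMeasure_discreteLaw {w : Ω → ℝ} (hw : ∀ ω, 0 ≤ w ω) (hw1 : ∑ ω, w ω = 1)
    (g : Ω → Y) : IsProbabilityMeasure (discreteLaw w g) := by
  classical
  refine ⟨?_⟩
  rw [discreteLaw_apply MeasurableSet.univ]
  simp only [Set.mem_univ, if_true]
  rw [← ENNReal.ofReal_sum_of_nonneg fun ω _ => hw ω, hw1, ENNReal.ofReal_one]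

theorem discreteLaw_eq_map [MeasurableSpace Ω] [DiscreteMeasurableSpace Ω] (w : Ω → ℝ)
    (g : Ω → Y) : discreteLaw w g = (discreteLaw w (id : Ω → Ω)).map g := by
  classical
  ext S hS
  rw [Measure.map_apply Measurable.of_discrete hS, discreteLaw_apply hS,
    discreteLaw_apply (Measurable.of_discrete hS)]
  simp

/-- The sample law is the image of a law on a finite discrete space, and the measure of a preimage
bounds the image measure from below even on non-measurable sets. Hence `S` may come from an
arbitrary learner. -/
theorem sum_productWeight_le_sampleLaw {X : Type u} [MeasurableSpace X] {N : ℕ}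
    (n : Fin (N + 1) → ℕ) {Ω : Type*} [Fintype Ω] (w : Fin (N + 1) → Ω → ℝ)
    (hw : ∀ t ω, 0 ≤ w t ω) (hw1 : ∀ t, ∑ ω, w t ω = 1) (g : Ω → X × Bool)
    (S : Set (MultiSample X n)) [DecidablePred (· ∈ S)] :
    ENNReal.ofReal (∑ a : (t : Fin (N + 1)) → Fin (n t) → Ω,
        if (fun t i => g (a t i)) ∈ S then productWeight w a else 0) ≤
      sampleLaw n (fun t => discreteLaw (w t) g) S := by
  classical
  let _ : MeasurableSpace Ω := ⊤
  have : DiscreteMeasurableSpace Ω := ⟨fun _ => trivial⟩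
  have : ∀ t, IsProbabilityMeasure (discreteLaw (w t) (id : Ω → Ω)) := fun t =>
    isProbabilityMeasure_discreteLaw (hw t) (hw1 t) _
  have : ∀ t, IsProbabilityMeasure ((discreteLaw (w t) (id : Ω → Ω)).map g) := fun t =>
    Measure.isProbabilityMeasure_map Measurable.of_discrete.aemeasurable
  have hg : Measurable g := Measurable.of_discrete
  let Q : Measure ((t : Fin (N + 1)) → Fin (n t) → Ω) :=
    Measure.pi fun t => Measure.pi fun _ : Fin (n t) => discreteLaw (w t) (id : Ω → Ω)
  have e1 : sampleLaw n (fun t => discreteLaw (w t) g) =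
      Q.map (fun a t i => g (a t i)) := by
    have inner : ∀ t, (Measure.pi fun _ : Fin (n t) => discreteLaw (w t) g) =
        (Measure.pi fun _ : Fin (n t) => discreteLaw (w t) (id : Ω → Ω)).map
          (fun b i => g (b i)) := fun t => by
      rw [discreteLaw_eq_map, Measure.pi_map_pi (fun _ => hg.aemeasurable)]
    have : ∀ t, IsProbabilityMeasure
        ((Measure.pi fun _ : Fin (n t) => discreteLaw (w t) (id : Ω → Ω)).map
          (fun b i => g (b i))) := fun t =>
      Measure.isProbabilityMeasure_map (Measurable.aemeasurable (by fun_prop))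
    unfold sampleLaw
    simp_rw [inner]
    exact (Measure.pi_map_pi (f := fun t (b : Fin (n t) → Ω) i => g (b i))
      (fun t => Measurable.aemeasurable (by fun_prop))).symm
  rw [e1]
  refine le_trans ?_ (Measure.le_map_apply (Measurable.aemeasurable (by fun_prop)) S)
  set S' : Set ((t : Fin (N + 1)) → Fin (n t) → Ω) := (fun a t i => g (a t i)) ⁻¹' S with hS'
  have hsing : ∀ a, Q {a} = ENNReal.ofReal (productWeight w a) := by
    intro a
    simp only [Q]
    rw [← Set.univ_pi_singleton, Measure.pi_pi]
    unfold productWeight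
    rw [ENNReal.ofReal_prod_of_nonneg fun t _ => Finset.prod_nonneg fun i _ => hw _ _]
    refine Finset.prod_congr rfl fun t _ => ?_
    rw [← Set.univ_pi_singleton, Measure.pi_pi,
      ENNReal.ofReal_prod_of_nonneg fun i _ => hw _ _]
    refine Finset.prod_congr rfl fun i _ => ?_
    rw [discreteLaw_apply (MeasurableSet.singleton _)]
    simp
  have : S' = ↑(Finset.univ.filter (· ∈ S')) := by simp
  rw [this, ← sum_measure_singleton]
  simp_rw [hsing]
  rw [Finset.sum_filter, ENNReal.ofReal_sum_of_nonneg]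
  · refine le_of_eq (Finset.sum_congr rfl fun a _ => ?_)
    simp only [hS', Set.mem_preimage]
    split_ifs <;> simp
  · intro a _
    split_ifs
    · exact Finset.prod_nonneg fun t _ => Finset.prod_nonneg fun i _ => hw _ _
    · rfl

end ProductLaw

/-! ### Excess risk relative to a minimizer, and measurability of error sets. -/

section ExcessRisk

variable {X : Type u} [MeasurableSpace X] {H : Set (Classifier X)} {P : Measure (X × Bool)}

theorem excessRisk_eq_of_isBest {hs : Classifier X} (hbest : IsBest H P hs) (h : Classifier X) :
    excessRisk H P h = risk P h - risk P hs := by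
  have : Nonempty H := ⟨⟨hs, hbest.1⟩⟩
  have h1 : ⨅ h' : H, risk P h'.1 = risk P hs :=
    le_antisymm (ciInf_le ⟨0, by rintro _ ⟨h', rfl⟩; exact measureReal_nonneg⟩ (⟨hs, hbest.1⟩ : H))
      (le_ciInf fun h' => hbest.2 h'.1 h'.2)
  rw [excessRisk, h1]

theorem measurableSet_error {h : Classifier X} (hh : Measurable h) :
    MeasurableSet {z : X × Bool | h z.1 ≠ z.2} :=
  (measurableSet_eq_fun (hh.comp measurable_fst) measurable_snd).compl

theorem measurableSet_disagreement {h h' : Classifier X} (hh : Measurable h)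
    (hh' : Measurable h') : MeasurableSet {z : X × Bool | h z.1 ≠ h' z.1} :=
  (measurableSet_eq_fun (hh.comp measurable_fst) (hh'.comp measurable_fst)).compl

end ExcessRisk

/-! ### The hard laws: an easy anchor and noisy hard atoms. -/

section MarginLaw

variable {κ : Type*} [Fintype κ]

theorem hammingCount_nonneg (d s : κ → Bool) : 0 ≤ hammingCount d s :=
  Finset.sum_nonneg fun j _ => by split_ifs <;> norm_num

theorem hammingCount_le_card (d s : κ → Bool) : hammingCount d s ≤ Fintype.card κ := by
  calc hammingCount d s ≤ ∑ _j : κ, (1 : ℝ) :=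
        Finset.sum_le_sum fun j _ => by split_ifs <;> norm_num
    _ = _ := by simp

theorem hammingCount_self (s : κ → Bool) : hammingCount s s = 0 := by simp [hammingCount]

theorem eq_of_hammingCount_eq_zero {d s : κ → Bool} (h : hammingCount d s = 0) : d = s := by
  funext j
  by_contra hne
  have := (Finset.sum_eq_zero_iff_of_nonneg (fun j _ => by split_ifs <;> norm_num)).1 h j
    (Finset.mem_univ j)
  simp [hne] at this

/-- The weights of a law with an easy atom of mass `1 - p` and uniformly spread hard atoms, of total
mass `p`, where the label `s j` is preferred by the margin `μ`. -/
noncomputable def marginWeight (p μ : ℝ) (s : κ → Bool) : Option (κ × Bool) → ℝ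
  | none => 1 - p
  | some (j, b) => p / Fintype.card κ * ((1 + if b = s j then μ else -μ) / 2)

/-- The labelled points that carry the weights `marginWeight`. -/
def marginPoint {X : Type u} (x₀ : X) (a : Bool) (x : κ → X) : Option (κ × Bool) → X × Bool
  | none => (x₀, a)
  | some (j, b) => (x j, b)

variable {p μ : ℝ}

theorem marginWeight_nonneg (hp0 : 0 ≤ p) (hp1 : p ≤ 1) (hμ0 : 0 ≤ μ) (hμ1 : μ ≤ 1)
    (s : κ → Bool) (ω : Option (κ × Bool)) : 0 ≤ marginWeight p μ s ω := by
  rcases ω with _ | ⟨j, b⟩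
  · simpa [marginWeight] using hp1
  · simp only [marginWeight]
    refine mul_nonneg (by positivity) ?_
    split_ifs <;> linarith

theorem sum_option_prod_bool (f : Option (κ × Bool) → ℝ) :
    ∑ ω, f ω = f none + ∑ j, (f (some (j, true)) + f (some (j, false))) := by
  rw [Fintype.sum_option, Fintype.sum_prod_type]
  simp

theorem sum_marginWeight [Nonempty κ] (s : κ → Bool) : ∑ ω, marginWeight p μ s ω = 1 := by
  have hk : (Fintype.card κ : ℝ) ≠ 0 := by exact_mod_cast Fintype.card_ne_zero
  rw [sum_option_prod_bool]
  have : ∀ j, marginWeight p μ s (some (j, true)) + marginWeight p μ s (some (j, false)) =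
      p / Fintype.card κ := fun j => by
    cases h : s j <;> simp [marginWeight, h] <;> ring
  simp_rw [this]
  simp [marginWeight]
  field_simp
  ring

theorem one_sub_le_affinity_marginWeight [DecidableEq κ] [Nonempty κ] (hp0 : 0 ≤ p) (hp1 : p ≤ 1)
    (hμ0 : 0 ≤ μ) (hμ1 : μ ≤ 1) (s : κ → Bool) (j : κ) :
    1 - p * μ ^ 2 / Fintype.card κ ≤
      ∑ ω, √(marginWeight p μ s ω * marginWeight p μ (flipAt j s) ω) := by
  have hk : (0 : ℝ) < Fintype.card κ := by exact_mod_cast Fintype.card_pos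
  -- Only the two atoms at `j` change, and there `√(1 - μ²) ≥ 1 - μ²`. The terms `±μ` in the
  -- correction cancel when both labels are summed.
  have key : ∀ ω, marginWeight p μ s ω - (match ω with
      | none => 0
      | some (i, b) => if i = j then
          p / Fintype.card κ * (μ ^ 2 + if b = s i then μ else -μ) / 2 else 0) ≤
      √(marginWeight p μ s ω * marginWeight p μ (flipAt j s) ω) := by
    rintro (_ | ⟨i, b⟩)
    · simp only [marginWeight, sub_zero]
      rw [Real.sqrt_mul_self (by linarith)]
    · by_cases hi : i = j
      · subst hi
        simp only [marginWeight, if_true]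
        have hb : (if b = flipAt i s i then μ else -μ) = -(if b = s i then μ else -μ) := by
          simp only [flipAt, Function.update_self]
          cases b <;> cases s i <;> simp
        rw [hb]
        set m : ℝ := if b = s i then μ else -μ with hm
        have hm2 : m ^ 2 = μ ^ 2 := by rw [hm]; split_ifs <;> ring
        set q := p / Fintype.card κ
        have hq : 0 ≤ q := by positivity
        apply Real.le_sqrt_of_sq_le
        have : 0 ≤ 1 - μ ^ 2 := by nlinarith
        have h2 : q * ((1 + m) / 2) * (q * ((1 + -m) / 2)) = q ^ 2 / 4 * (1 - μ ^ 2) := by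
          rw [← hm2]; ring
        rw [h2]
        have h3 : (q * ((1 + m) / 2) - q * (μ ^ 2 + m) / 2) ^ 2 =
            q ^ 2 / 4 * (1 - μ ^ 2) ^ 2 := by ring
        rw [h3]
        apply mul_le_mul_of_nonneg_left _ (by positivity)
        nlinarith
      · simp only [marginWeight, hi, if_false, sub_zero]
        have : flipAt j s i = s i := by simp [flipAt, hi]
        rw [this, Real.sqrt_mul_self]
        exact marginWeight_nonneg hp0 hp1 hμ0 hμ1 s (some (i, b))
  refine le_trans (le_of_eq ?_) (Finset.sum_le_sum fun ω _ => key ω)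
  rw [Finset.sum_sub_distrib, sum_marginWeight, sum_option_prod_bool]
  simp only [zero_add]
  congr 1
  have : ∀ i, ((if i = j then
      p / Fintype.card κ * (μ ^ 2 + if true = s i then μ else -μ) / 2 else 0) +
      if i = j then p / Fintype.card κ * (μ ^ 2 + if false = s i then μ else -μ) / 2 else 0) =
      if i = j then p * μ ^ 2 / Fintype.card κ else 0 := fun i => by
    split_ifs <;> simp_all <;> ring
  simp_rw [this]
  simp

variable {X : Type u} [MeasurableSpace X]

/-- The law with weights `marginWeight`. -/
noncomputable def marginLaw (x₀ : X) (a : Bool) (x : κ → X) (p μ : ℝ) (s : κ → Bool) :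
    Measure (X × Bool) :=
  discreteLaw (marginWeight p μ s) (marginPoint x₀ a x)

variable {x₀ : X} {a : Bool} {x : κ → X} {s : κ → Bool} {h h' : Classifier X}

/-- Label noise costs every classifier `p (1 - μ) / 2`; each hard atom labelled against `s` adds its
mass times `μ`, and an error at the anchor adds `1 - p`. -/
theorem risk_marginLaw [Nonempty κ] (hp0 : 0 ≤ p) (hp1 : p ≤ 1) (hμ0 : 0 ≤ μ) (hμ1 : μ ≤ 1)
    (hh : Measurable h) :
    risk (marginLaw x₀ a x p μ s) h = p * (1 - μ) / 2 +
      ((1 - p) * (if h x₀ ≠ a then 1 else 0) +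
        p * μ * (hammingCount (fun j => h (x j)) s / Fintype.card κ)) := by
  classical
  have hk : (Fintype.card κ : ℝ) ≠ 0 := by exact_mod_cast Fintype.card_ne_zero
  rw [risk, marginLaw, real_discreteLaw (marginWeight_nonneg hp0 hp1 hμ0 hμ1 s)
    (measurableSet_error hh), sum_option_prod_bool]
  have : ∀ j, ((if marginPoint x₀ a x (some (j, true)) ∈ {z : X × Bool | h z.1 ≠ z.2} then
        marginWeight p μ s (some (j, true)) else 0) +
      if marginPoint x₀ a x (some (j, false)) ∈ {z : X × Bool | h z.1 ≠ z.2} then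
        marginWeight p μ s (some (j, false)) else 0) =
      p / Fintype.card κ * ((1 - μ) / 2) +
        p / Fintype.card κ * μ * (if h (x j) ≠ s j then 1 else 0) := fun j => by
    cases h1 : h (x j) <;> cases h2 : s j <;> simp [marginWeight, marginPoint, h1, h2] <;>
      first | (left; ring1) | ring1
  simp_rw [this]
  rw [Finset.sum_add_distrib, Finset.sum_const, Finset.card_univ, nsmul_eq_mul, ← Finset.mul_sum,
    hammingCount]
  have h0 : (if marginPoint x₀ a x none ∈ {z : X × Bool | h z.1 ≠ z.2} then
      marginWeight p μ s none else 0) = (1 - p) * (if h x₀ ≠ a then 1 else 0) := by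
    by_cases h1 : h x₀ = a <;> simp [marginPoint, marginWeight, h1]
  rw [h0]
  field_simp
  ring

theorem disagreement_marginLaw [Nonempty κ] (hp0 : 0 ≤ p) (hp1 : p ≤ 1) (hμ0 : 0 ≤ μ)
    (hμ1 : μ ≤ 1) (hh : Measurable h) (hh' : Measurable h') :
    disagreement (marginLaw x₀ a x p μ s) h h' =
      (1 - p) * (if h x₀ ≠ h' x₀ then 1 else 0) +
        p * (hammingCount (fun j => h (x j)) (fun j => h' (x j)) / Fintype.card κ) := by
  classical
  have hk : (Fintype.card κ : ℝ) ≠ 0 := by exact_mod_cast Fintype.card_ne_zero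
  rw [disagreement, marginLaw, real_discreteLaw (marginWeight_nonneg hp0 hp1 hμ0 hμ1 s)
    (measurableSet_disagreement hh hh'), sum_option_prod_bool]
  have : ∀ j, ((if marginPoint x₀ a x (some (j, true)) ∈ {z : X × Bool | h z.1 ≠ h' z.1} then
        marginWeight p μ s (some (j, true)) else 0) +
      if marginPoint x₀ a x (some (j, false)) ∈ {z : X × Bool | h z.1 ≠ h' z.1} then
        marginWeight p μ s (some (j, false)) else 0) =
        p / Fintype.card κ * (if h (x j) ≠ h' (x j) then 1 else 0) := fun j => by
    by_cases h1 : h (x j) = h' (x j)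
    · simp [marginPoint, h1]
    · cases h2 : s j <;> simp [marginWeight, marginPoint, h1, h2] <;> ring
  simp_rw [this]
  rw [← Finset.mul_sum, hammingCount]
  have h0 : (if marginPoint x₀ a x none ∈ {z : X × Bool | h z.1 ≠ h' z.1} then
      marginWeight p μ s none else 0) = (1 - p) * (if h x₀ ≠ h' x₀ then 1 else 0) := by
    by_cases h1 : h x₀ = h' x₀ <;> simp [marginPoint, marginWeight, h1]
  rw [h0]
  field_simp

variable {H : Set (Classifier X)}

theorem isBest_marginLaw [Nonempty κ] (hp0 : 0 ≤ p) (hp1 : p ≤ 1) (hμ0 : 0 ≤ μ) (hμ1 : μ ≤ 1)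
    (hH : ∀ h ∈ H, Measurable h) (hmem : h ∈ H) (h0 : h x₀ = a) (hs : ∀ j, h (x j) = s j) :
    IsBest H (marginLaw x₀ a x p μ s) h := by
  refine ⟨hmem, fun h' hm' => ?_⟩
  rw [risk_marginLaw hp0 hp1 hμ0 hμ1 (hH _ hmem), risk_marginLaw hp0 hp1 hμ0 hμ1 (hH _ hm')]
  have : (fun j => h (x j)) = s := funext hs
  rw [this, hammingCount_self]
  simp only [h0, ne_eq, not_true, if_false]
  have h1 : 0 ≤ (1 - p) * (if ¬ h' x₀ = a then (1 : ℝ) else 0) :=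
    mul_nonneg (by linarith) (by split_ifs <;> norm_num)
  have h2 : 0 ≤ p * μ * (hammingCount (fun j => h' (x j)) s / Fintype.card κ) :=
    mul_nonneg (mul_nonneg hp0 hμ0) (div_nonneg (hammingCount_nonneg _ _) (by positivity))
  simp only [mul_zero, zero_div, add_zero]
  linarith

theorem excessRisk_marginLaw [Nonempty κ] (hp0 : 0 ≤ p) (hp1 : p ≤ 1) (hμ0 : 0 ≤ μ) (hμ1 : μ ≤ 1)
    (hH : ∀ h ∈ H, Measurable h) (hex : ∃ h ∈ H, h x₀ = a ∧ ∀ j, h (x j) = s j) (hmem : h ∈ H) :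
    excessRisk H (marginLaw x₀ a x p μ s) h = (1 - p) * (if h x₀ ≠ a then 1 else 0) +
        p * μ * (hammingCount (fun j => h (x j)) s / Fintype.card κ) := by
  obtain ⟨g, hg, hg0, hgs⟩ := hex
  rw [excessRisk_eq_of_isBest (isBest_marginLaw hp0 hp1 hμ0 hμ1 hH hg hg0 hgs),
    risk_marginLaw hp0 hp1 hμ0 hμ1 (hH _ hmem), risk_marginLaw hp0 hp1 hμ0 hμ1 (hH _ hg)]
  have : (fun j => g (x j)) = s := funext hgs
  rw [this, hammingCount_self]
  simp only [hg0]
  simp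

theorem one_le_two_mul_rpow {r E : ℝ} (hr0 : 0 ≤ r) (hr1 : r ≤ 1) (hE : 1 / 2 ≤ E) :
    1 ≤ 2 * E ^ r := by
  have h1 : (1 / 2 : ℝ) ^ r ≤ E ^ r := Real.rpow_le_rpow (by norm_num) hE hr0
  have h2 : (1 / 2 : ℝ) ^ (1 : ℝ) ≤ (1 / 2 : ℝ) ^ r :=
    Real.rpow_le_rpow_of_exponent_ge (by norm_num) (by norm_num) hr1
  rw [Real.rpow_one] at h2
  linarith

theorem hammingCount_div_mem [Nonempty κ] (d s : κ → Bool) :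
    0 ≤ hammingCount d s / Fintype.card κ ∧ hammingCount d s / Fintype.card κ ≤ 1 :=
  ⟨div_nonneg (hammingCount_nonneg _ _) (by positivity),
    div_le_one_of_le₀ (hammingCount_le_card _ _) (by positivity)⟩

/-- A classifier that errs at the anchor has excess risk at least `1 / 2`, which makes the condition
trivial for it. So only the inequality `key` on the hard atoms matters. -/
theorem bernsteinClass_marginLaw [Nonempty κ] {Cβ β : ℝ} (hp0 : 0 ≤ p) (hp1 : p ≤ 1 / 2)
    (hμ0 : 0 < μ) (hμ1 : μ ≤ 1) (hH : ∀ h ∈ H, Measurable h)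
    (hex : ∃ h ∈ H, h x₀ = a ∧ ∀ j, h (x j) = s j) (hC : 2 ≤ Cβ) (hβ0 : 0 ≤ β) (hβ1 : β ≤ 1)
    (key : ∀ v : ℝ, 0 ≤ v → v ≤ 1 → p * v ≤ 2 * (p * μ * v) ^ β) :
    BernsteinClass H (marginLaw x₀ a x p μ s) Cβ β := by
  intro hs hbest h hmem
  have e0 : excessRisk H (marginLaw x₀ a x p μ s) hs = 0 := by
    rw [excessRisk_eq_of_isBest hbest]; ring
  rw [excessRisk_marginLaw hp0 (by linarith) hμ0.le hμ1 hH hex hbest.1] at e0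
  have hv := hammingCount_div_mem (fun j => hs (x j)) s
  have hv' := hammingCount_div_mem (fun j => h (x j)) s
  have e1 : 0 ≤ p * μ * (hammingCount (fun j => hs (x j)) s / Fintype.card κ) :=
    mul_nonneg (mul_nonneg hp0 hμ0.le) hv.1
  have hx0 : hs x₀ = a := by
    by_contra hne
    simp only [ne_eq, hne, not_false_eq_true, if_true] at e0
    linarith
  -- An arbitrary minimizer agrees with `s` on all hard atoms unless `p = 0`, in which case they do
  -- not count.
  have hd : disagreement (marginLaw x₀ a x p μ s) h hs = (1 - p) * (if h x₀ ≠ a then 1 else 0) +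
        p * (hammingCount (fun j => h (x j)) s / Fintype.card κ) := by
    rw [disagreement_marginLaw hp0 (by linarith) hμ0.le hμ1 (hH _ hmem) (hH _ hbest.1), hx0]
    simp only [hx0, ne_eq, not_true, if_false, mul_zero, zero_add, mul_eq_zero, div_eq_zero_iff]
      at e0
    have hk : (Fintype.card κ : ℝ) ≠ 0 := by exact_mod_cast Fintype.card_ne_zero
    rcases e0 with (hp | hμ) | hz | hz
    · simp [hp]
    · exact absurd hμ hμ0.ne'
    · rw [eq_of_hammingCount_eq_zero hz]
    · exact absurd hz hk
  rw [hd, excessRisk_marginLaw hp0 (by linarith) hμ0.le hμ1 hH hex hmem]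
  set v := hammingCount (fun j => h (x j)) s / Fintype.card κ
  by_cases hx : h x₀ = a
  · simp only [hx, ne_eq, not_true, if_false, mul_zero, zero_add]
    refine (key v hv'.1 hv'.2).trans ?_
    exact mul_le_mul_of_nonneg_right hC
      (Real.rpow_nonneg (mul_nonneg (mul_nonneg hp0 hμ0.le) hv'.1) _)
  · simp only [hx, ne_eq, not_false_eq_true, if_true, mul_one]
    have h1 : 1 / 2 ≤ 1 - p + p * μ * v := by
      nlinarith [mul_nonneg (mul_nonneg hp0 hμ0.le) hv'.1]
    have h2 := one_le_two_mul_rpow hβ0 hβ1 h1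
    have h3 : p * v ≤ p := by nlinarith
    nlinarith [Real.rpow_nonneg (by linarith : (0:ℝ) ≤ 1 - p + p * μ * v) β]

theorem transferExponent_marginLaw [Nonempty κ] {Cρ pD μD : ℝ} {ρ : ℝ≥0∞} (hp0 : 0 ≤ p)
    (hp1 : p ≤ 1 / 2) (hμ0 : 0 ≤ μ) (hμ1 : μ ≤ 1) (hpD0 : 0 ≤ pD) (hpD1 : pD ≤ 1 / 2)
    (hμD0 : 0 ≤ μD) (hμD1 : μD ≤ 1) (hH : ∀ h ∈ H, Measurable h)
    (hex : ∃ h ∈ H, h x₀ = a ∧ ∀ j, h (x j) = s j) (hC : 2 ≤ Cρ) (hρ : (ρ⁻¹).toReal ≤ 1)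
    (key : ∀ v : ℝ, 0 ≤ v → v ≤ 1 → pD * μD * v ≤ 2 * (p * μ * v) ^ (ρ⁻¹).toReal) :
    TransferExponent H (marginLaw x₀ a x p μ s) (marginLaw x₀ a x pD μD s) Cρ ρ := by
  intro h hmem
  rw [excessRisk_marginLaw hp0 (by linarith) hμ0 hμ1 hH hex hmem,
    excessRisk_marginLaw hpD0 (by linarith) hμD0 hμD1 hH hex hmem]
  have hv' := hammingCount_div_mem (fun j => h (x j)) s
  set v := hammingCount (fun j => h (x j)) s / Fintype.card κ
  have hr : 0 ≤ (ρ⁻¹).toReal := ENNReal.toReal_nonneg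
  set r := (ρ⁻¹).toReal
  by_cases hx : h x₀ = a
  · simp only [hx, ne_eq, not_true, if_false, mul_zero, zero_add]
    refine (key v hv'.1 hv'.2).trans ?_
    exact mul_le_mul_of_nonneg_right hC
      (Real.rpow_nonneg (mul_nonneg (mul_nonneg hp0 hμ0) hv'.1) _)
  · simp only [hx, ne_eq, not_false_eq_true, if_true, mul_one]
    have h0 : 0 ≤ p * μ * v := mul_nonneg (mul_nonneg hp0 hμ0) hv'.1
    have h1 : 1 / 2 ≤ 1 - p + p * μ * v := by linarith
    have h2 := one_le_two_mul_rpow hr hρ h1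
    have h3 : pD * μD * v ≤ pD := by
      have : μD * v ≤ 1 := mul_le_one₀ hμD1 hv'.1 hv'.2
      nlinarith
    nlinarith [Real.rpow_nonneg (by linarith : (0:ℝ) ≤ 1 - p + p * μ * v) r]

end MarginLaw

/-! ### Shattered points with a common anchor. -/

section ShatteredPoints

variable {X : Type u} {H : Set (Classifier X)}

/-- A class with at least three classifiers and VC dimension `V` realizes all labellings of some
`k ≥ V / 2` points by classifiers that agree at a further point. -/
theorem exists_points_of_hasVCDim {V : ℕ} (hcard : 3 ≤ H.encard) (hV : HasVCDim H V) :
    ∃ (k : ℕ) (x₀ : X) (a : Bool) (x : Fin k → X), 1 ≤ k ∧ V ≤ 2 * k ∧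
      ∀ s : Fin k → Bool, ∃ h ∈ H, h x₀ = a ∧ ∀ j, h (x j) = s j := by
  classical
  rcases le_or_gt V 1 with hV1 | hV2
  · obtain ⟨T, hTH, hT⟩ := Set.exists_subset_encard_eq hcard
    obtain ⟨h1, h2, h3, d12, d13, d23, rfl⟩ := Set.encard_eq_three.1 hT
    have m1 : h1 ∈ H := hTH (by simp)
    have m2 : h2 ∈ H := hTH (by simp)
    have m3 : h3 ∈ H := hTH (by simp)
    have main : ∀ g ∈ H, ∀ g' ∈ H, ∀ x₀ : X, g ≠ g' → g x₀ = g' x₀ →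
        ∃ (k : ℕ) (x₀ : X) (a : Bool) (x : Fin k → X), 1 ≤ k ∧ V ≤ 2 * k ∧
          ∀ s : Fin k → Bool, ∃ h ∈ H, h x₀ = a ∧ ∀ j, h (x j) = s j := by
      intro g hg g' hg' x₀ hne he
      obtain ⟨y, hy⟩ := Function.ne_iff.1 hne
      refine ⟨1, x₀, g x₀, fun _ => y, le_rfl, by omega, fun s => ?_⟩
      by_cases hs : g y = s 0
      · exact ⟨g, hg, rfl, fun j => by rw [Subsingleton.elim j 0]; exact hs⟩
      · refine ⟨g', hg', he.symm, fun j => ?_⟩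
        rw [Subsingleton.elim j 0]
        revert hs hy
        cases g y <;> cases g' y <;> cases s 0 <;> simp
    -- Labels are binary: at a point where `h1` and `h2` differ, `h3` agrees with one of them. That
    -- point is the anchor, and a point separating the agreeing pair is the single hard point.
    obtain ⟨y, hy⟩ := Function.ne_iff.1 d12
    by_cases h31 : h1 y = h3 y
    · exact main h1 m1 h3 m3 y d13 h31
    · refine main h2 m2 h3 m3 y d23 ?_
      revert hy h31
      cases h1 y <;> cases h2 y <;> cases h3 y <;> simp
  -- For `V ≥ 2` one shattered point becomes the anchor, and `V ≤ 2 (V - 1)`.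
  · obtain ⟨⟨S, hS, hsh⟩, -⟩ := hV
    obtain ⟨x₀, hx₀⟩ : S.Nonempty := Finset.card_pos.1 (by omega)
    have hc : (S.erase x₀).card = V - 1 := by rw [Finset.card_erase_of_mem hx₀, hS]
    let e := (S.erase x₀).equivFinOfCardEq hc
    refine ⟨V - 1, x₀, true, fun j => (e.symm j : X), by omega, by omega, fun s => ?_⟩
    obtain ⟨h, hm, hh⟩ := hsh fun y => if hy : y ∈ S.erase x₀ then s (e ⟨y, hy⟩) else true
    refine ⟨h, hm, by rw [hh x₀ hx₀]; simp, fun j => ?_⟩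
    have hj := (e.symm j).2
    rw [hh _ (Finset.mem_of_mem_erase hj), dif_pos hj]
    simp

end ShatteredPoints

/-! ### Calibration of the hard laws at scale `ε`. -/

section LowerBound

theorem Params.one_le_exponent {N : ℕ} (M : Params N) (hρ : ∀ t, 1 ≤ M.ρ t) (t : Fin (N + 1)) :
    1 ≤ M.exponent t := by
  refine Fin.lastCases ?_ (fun i => ?_) t
  · simp [Params.exponent]
  · simpa [Params.exponent] using hρ i

/-- The mass of the hard atoms for a task with excess risk scale `ε ^ ρ`. -/
noncomputable def hardMass (ε β : ℝ) (ρ : ℝ≥0∞) : ℝ :=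
  if ρ = ∞ then 0 else (ε ^ ρ.toReal) ^ β / 2

/-- The margin at the hard atoms for a task with excess risk scale `ε ^ ρ`. -/
noncomputable def hardMargin (ε β : ℝ) (ρ : ℝ≥0∞) : ℝ :=
  if ρ = ∞ then 1 / 2 else (ε ^ ρ.toReal) ^ (1 - β) / 2

variable {ε β : ℝ} {ρ : ℝ≥0∞}

theorem rpow_mem_Ioc (hε : 0 < ε) (hε1 : ε ≤ 1) {r : ℝ} (hr : 0 ≤ r) :
    0 < ε ^ r ∧ ε ^ r ≤ 1 :=
  ⟨Real.rpow_pos_of_pos hε _, Real.rpow_le_one hε.le hε1 hr⟩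

theorem hardMass_mem (hε : 0 < ε) (hε1 : ε ≤ 1) (hβ0 : 0 ≤ β) :
    0 ≤ hardMass ε β ρ ∧ hardMass ε β ρ ≤ 1 / 2 := by
  unfold hardMass
  split_ifs
  · norm_num
  · have h1 := rpow_mem_Ioc hε hε1 (r := ρ.toReal) ENNReal.toReal_nonneg
    have h2 := rpow_mem_Ioc h1.1 h1.2 hβ0
    constructor <;> linarith

theorem hardMargin_mem (hε : 0 < ε) (hε1 : ε ≤ 1) (hβ1 : β ≤ 1) :
    0 < hardMargin ε β ρ ∧ hardMargin ε β ρ ≤ 1 := by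
  unfold hardMargin
  split_ifs
  · norm_num
  · have h1 := rpow_mem_Ioc hε hε1 (r := ρ.toReal) ENNReal.toReal_nonneg
    have h2 := rpow_mem_Ioc h1.1 h1.2 (sub_nonneg.2 hβ1)
    constructor <;> linarith

theorem hardMass_mul_hardMargin (hε : 0 < ε) (hρ : ρ ≠ ∞) :
    hardMass ε β ρ * hardMargin ε β ρ = ε ^ ρ.toReal / 4 := by
  have h1 : 0 < ε ^ ρ.toReal := Real.rpow_pos_of_pos hε _
  rw [hardMass, hardMargin, if_neg hρ, if_neg hρ]
  have : (ε ^ ρ.toReal) ^ β * (ε ^ ρ.toReal) ^ (1 - β) = ε ^ ρ.toReal := by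
    rw [← Real.rpow_add h1]; simp
  linear_combination this / 4

/-- Up to the factor `1 / k`, this is the affinity defect of one observation; it brings in the
exponent `(2 - β)ρ`. -/
theorem hardMass_mul_hardMargin_sq (hε : 0 < ε) :
    hardMass ε β ρ * hardMargin ε β ρ ^ 2 =
      (if ρ = ∞ then 0 else ε ^ ((2 - β) * ρ.toReal)) / 8 := by
  have h1 : 0 < ε ^ ρ.toReal := Real.rpow_pos_of_pos hε _
  rw [hardMass, hardMargin]
  split_ifs
  · simp
  · have : (ε ^ ρ.toReal) ^ β * ((ε ^ ρ.toReal) ^ (1 - β)) ^ 2 = ε ^ ((2 - β) * ρ.toReal) := by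
      rw [← Real.rpow_natCast ((ε ^ ρ.toReal) ^ (1 - β)), ← Real.rpow_mul h1.le,
        ← Real.rpow_add h1, ← Real.rpow_mul hε.le]
      congr 1
      push_cast
      ring
    linear_combination this / 8

theorem quarter_mul_le_rpow {v r : ℝ} (hv0 : 0 ≤ v) (hv1 : v ≤ 1) (hr1 : r ≤ 1) :
    v / 4 ≤ (v / 4) ^ r := by
  rcases hv0.eq_or_lt with rfl | hv
  · simpa using Real.rpow_nonneg le_rfl r
  · calc v / 4 = (v / 4) ^ (1 : ℝ) := (Real.rpow_one _).symm
      _ ≤ _ := Real.rpow_le_rpow_of_exponent_ge (by positivity) (by linarith) hr1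

theorem hard_bernstein (hε : 0 < ε) (hβ1 : β ≤ 1) {v : ℝ} (hv0 : 0 ≤ v)
    (hv1 : v ≤ 1) :
    hardMass ε β ρ * v ≤ 2 * (hardMass ε β ρ * hardMargin ε β ρ * v) ^ β := by
  by_cases hρ : ρ = ∞
  · have : hardMass ε β ρ = 0 := by simp [hardMass, hρ]
    rw [this]
    simp only [zero_mul]
    exact mul_nonneg (by norm_num) (Real.rpow_nonneg le_rfl _)
  · have h1 : 0 < ε ^ ρ.toReal := Real.rpow_pos_of_pos hε _
    rw [hardMass_mul_hardMargin hε hρ, hardMass, if_neg hρ, div_mul_eq_mul_div,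
      div_mul_eq_mul_div, mul_div_assoc, mul_div_assoc, Real.mul_rpow h1.le (by positivity)]
    have h2 := quarter_mul_le_rpow hv0 hv1 hβ1
    have h3 : 0 < (ε ^ ρ.toReal) ^ β := Real.rpow_pos_of_pos h1 _
    nlinarith

theorem hard_transfer (hε : 0 < ε) (hε1 : ε ≤ 1) (hρ1 : 1 ≤ ρ) {v : ℝ} (hv0 : 0 ≤ v)
    (hv1 : v ≤ 1) :
    hardMass ε β 1 * hardMargin ε β 1 * v ≤
      2 * (hardMass ε β ρ * hardMargin ε β ρ * v) ^ (ρ⁻¹).toReal := by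
  rw [hardMass_mul_hardMargin hε ENNReal.one_ne_top]
  simp only [ENNReal.toReal_one, Real.rpow_one]
  by_cases hρ : ρ = ∞
  -- A source with `ρ = ∞` has no hard mass, but the exponent `0` and `0 ^ 0 = 1` make the
  -- right-hand side equal to `2`.
  · subst hρ
    simp
    nlinarith
  · have h1 : 1 ≤ ρ.toReal := by
      simpa using (ENNReal.toReal_le_toReal ENNReal.one_ne_top hρ).2 hρ1
    rw [hardMass_mul_hardMargin hε hρ, ENNReal.toReal_inv, div_mul_eq_mul_div, div_mul_eq_mul_div,
      mul_div_assoc, mul_div_assoc,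
      Real.mul_rpow (Real.rpow_nonneg hε.le _) (by positivity), ← Real.rpow_mul hε.le,
      mul_inv_cancel₀ (by positivity), Real.rpow_one]
    have h2 := quarter_mul_le_rpow hv0 hv1 (inv_le_one_of_one_le₀ h1)
    nlinarith [mul_nonneg hε.le (show 0 ≤ v / 4 by positivity)]

theorem toReal_inv_le_one (hρ1 : 1 ≤ ρ) : (ρ⁻¹).toReal ≤ 1 := by
  have : ρ⁻¹ ≤ 1 := ENNReal.inv_le_one.2 hρ1
  simpa using ENNReal.toReal_mono ENNReal.one_ne_top this

variable {X : Type u} [MeasurableSpace X] {H : Set (Classifier X)}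

/-- If the sources carry little information at the excess risk scale `ε`, then no learner beats
that scale. -/
theorem exists_mem_of_information_le (hH : ∀ h ∈ H, Measurable h) {κ : Type*} [Fintype κ]
    [DecidableEq κ] [Nonempty κ] {x₀ : X} {a : Bool} {x : κ → X}
    (hreal : ∀ s : κ → Bool, ∃ h ∈ H, h x₀ = a ∧ ∀ j, h (x j) = s j) {N : ℕ} (M : Params N)
    (hρ : ∀ t, 1 ≤ M.ρ t) (hε : 0 < ε) (hε1 : ε ≤ 1)
    (hinfo : ∑ t, (M.n t : ℝ) * (if M.exponent t = ∞ then 0 else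
      ε ^ ((2 - M.β) * (M.exponent t).toReal)) ≤ 4 * Fintype.card κ)
    (A : MultiSample X M.n → Classifier X) (hA : IsLearner H A) :
    ∃ P : Fin (N + 1) → Measure (X × Bool), M.Mem H P ∧
      1 / 50 ≤ sampleLaw M.n P {z | ε / 200 < excessRisk H (P (Fin.last N)) (A z)} := by
  classical
  have hk : (0 : ℝ) < Fintype.card κ := by exact_mod_cast Fintype.card_pos
  have hk1 : (1 : ℝ) ≤ Fintype.card κ := by exact_mod_cast Fintype.card_pos
  set p : Fin (N + 1) → ℝ := fun t => hardMass ε M.β (M.exponent t) with hp_def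
  set μ : Fin (N + 1) → ℝ := fun t => hardMargin ε M.β (M.exponent t) with hμ_def
  have hp : ∀ t, 0 ≤ p t ∧ p t ≤ 1 / 2 := fun t => hardMass_mem hε hε1 M.β_nonneg
  have hp1 : ∀ t, p t ≤ 1 := fun t => (hp t).2.trans (by norm_num)
  have hμ : ∀ t, 0 < μ t ∧ μ t ≤ 1 := fun t => hardMargin_mem hε hε1 M.β_le_one
  have hw0 : ∀ s t ω, 0 ≤ marginWeight (κ := κ) (p t) (μ t) s ω := fun s t =>
    marginWeight_nonneg (hp t).1 (hp1 t) (hμ t).1.le (hμ t).2 s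
  obtain ⟨s, hs⟩ := exists_le_prob_hammingCount
    (α := (t : Fin (N + 1)) → Fin (M.n t) → Option (κ × Bool))
    (fun s a => productWeight (fun t => marginWeight (p t) (μ t) s) a)
    (fun s a => Finset.prod_nonneg fun t _ => Finset.prod_nonneg fun i _ => hw0 _ _ _)
    (fun s => by
      rw [sum_productWeight]
      simp only [sum_marginWeight, one_pow, Finset.prod_const_one])
    (fun s j => by
      refine le_trans ?_ (one_sub_sum_le_affinity M.n _ _ (hw0 s) (hw0 _)
        (fun t => p t * μ t ^ 2 / Fintype.card κ) (fun t => ?_) (fun t => ?_)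
        fun t => one_sub_le_affinity_marginWeight (hp t).1 (hp1 t) (hμ t).1.le (hμ t).2 s j)
      · simp only [hp_def, hμ_def, hardMass_mul_hardMargin_sq hε]
        have : ∀ t, (M.n t : ℝ) * ((if M.exponent t = ∞ then 0 else
            ε ^ ((2 - M.β) * (M.exponent t).toReal)) / 8 / Fintype.card κ) =
            (M.n t : ℝ) * (if M.exponent t = ∞ then 0 else
            ε ^ ((2 - M.β) * (M.exponent t).toReal)) / (8 * Fintype.card κ) := fun t => by
          rw [div_div, mul_div_assoc]
        simp_rw [this]
        rw [← Finset.sum_div]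
        have h5 : (∑ t, (M.n t : ℝ) * (if M.exponent t = ∞ then 0 else
            ε ^ ((2 - M.β) * (M.exponent t).toReal))) / (8 * Fintype.card κ) ≤ 1 / 2 := by
          rw [div_le_iff₀ (by positivity)]
          linarith
        linarith
      · exact div_nonneg (mul_nonneg (hp t).1 (sq_nonneg _)) hk.le
      · refine div_le_one_of_le₀ (le_trans ?_ hk1) hk.le
        exact mul_le_one₀ (hp1 t) (sq_nonneg _) (pow_le_one₀ (hμ t).1.le (hμ t).2))
    -- The decoder reads off the labels that the learner assigns to the hard points.
    (fun b j => A (fun t i => marginPoint x₀ a x (b t i)) (x j))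
  have hex := hreal s
  obtain ⟨g, hg, hg0, hgs⟩ := hex
  have hlast : M.exponent (Fin.last N) = 1 := by simp [Params.exponent]
  refine ⟨fun t => marginLaw x₀ a x (p t) (μ t) s, ⟨fun t => ?_, ⟨g, fun t => ?_⟩, fun t => ?_,
    fun t => ?_⟩, ?_⟩
  · exact isProbabilityMeasure_discreteLaw (hw0 s t) (sum_marginWeight s) _
  · exact isBest_marginLaw (hp t).1 (hp1 t) (hμ t).1.le (hμ t).2 hH hg hg0 hgs
  · refine transferExponent_marginLaw (hp _).1 (hp _).2 (hμ _).1.le (hμ _).2 (hp _).1 (hp _).2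
      (hμ _).1.le (hμ _).2 hH (hreal s) M.two_le_Cρ (toReal_inv_le_one (hρ t)) fun v hv0 hv1 => ?_
    have h1 : M.exponent t.castSucc = M.ρ t := by simp [Params.exponent]
    simp only [hp_def, hμ_def, hlast, h1]
    exact hard_transfer hε hε1 (hρ t) hv0 hv1
  · exact bernsteinClass_marginLaw (hp t).1 (hp t).2 (hμ t).1 (hμ t).2 hH (hreal s) M.two_le_Cβ
      M.β_nonneg M.β_le_one fun v hv0 hv1 => hard_bernstein hε M.β_le_one hv0 hv1
  · refine le_trans ?_ (sum_productWeight_le_sampleLaw M.n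
      (fun t => marginWeight (p t) (μ t) s) (hw0 s) (fun t => sum_marginWeight s)
      (marginPoint x₀ a x) _)
    have h50 : (1 / 50 : ℝ≥0∞) = ENNReal.ofReal (1 / 50) := by
      rw [ENNReal.ofReal_div_of_pos (by norm_num)]; simp
    rw [h50]
    refine ENNReal.ofReal_le_ofReal (hs.trans (Finset.sum_le_sum fun b _ => ?_))
    have hpos : 0 ≤ productWeight (fun t => marginWeight (p t) (μ t) s) b :=
      Finset.prod_nonneg fun t _ => Finset.prod_nonneg fun i _ => hw0 _ _ _
    by_cases hb : (Fintype.card κ : ℝ) / 50 < hammingCount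
        (fun j => A (fun t i => marginPoint x₀ a x (b t i)) (x j)) s
    · rw [if_pos hb, if_pos]
      simp only [Set.mem_ofPred_eq]
      rw [excessRisk_marginLaw (hp _).1 (hp1 _) (hμ _).1.le (hμ _).2 hH (hreal s) (hA _)]
      -- The target has exponent `1`; more than a `1 / 50` share of wrong hard atoms costs more than
      -- `ε / 4 / 50 = ε / 200`.
      have h2 : p (Fin.last N) * μ (Fin.last N) = ε / 4 := by
        simp only [hp_def, hμ_def, hlast]
        rw [hardMass_mul_hardMargin hε ENNReal.one_ne_top]
        simp
      rw [h2]
      have h3 : (1 / 50 : ℝ) < hammingCount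
          (fun j => A (fun t i => marginPoint x₀ a x (b t i)) (x j)) s / Fintype.card κ := by
        rw [lt_div_iff₀ hk]; linarith
      have h4 : 0 ≤ (1 - p (Fin.last N)) * (if A (fun t i => marginPoint x₀ a x (b t i)) x₀ ≠ a
          then (1 : ℝ) else 0) :=
        mul_nonneg (by linarith [hp1 (Fin.last N)]) (by split_ifs <;> norm_num)
      nlinarith
    · rw [if_neg hb]
      split_ifs
      · exact hpos
      · rfl

end LowerBound

/-! ### Telescoping over prefix sizes: the squared logarithm. -/

section Telescoping

theorem one_le_posLog (x : ℝ) : 1 ≤ posLog x := le_max_right _ _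

theorem posLog_pos (x : ℝ) : 0 < posLog x := one_pos.trans_le (one_le_posLog x)

/-- Discrete form of `∫ dx / (x (1 + log x)²) = -1 / (1 + log x)`, resting on `1 - b / c ≤ log (c /
b)`. -/
theorem sub_div_mul_sq_log_le {b c : ℝ} (hb : 1 ≤ b) (hbc : b ≤ c) :
    (c - b) / (c * (1 + Real.log c) ^ 2) ≤ 1 / (1 + Real.log b) - 1 / (1 + Real.log c) := by
  have hb0 : 0 < b := by linarith
  have hc0 : 0 < c := by linarith
  have l0 : 0 ≤ Real.log b := Real.log_nonneg hb
  have l1 : Real.log b ≤ Real.log c := Real.log_le_log hb0 hbc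
  have l2 : (c - b) / c ≤ Real.log c - Real.log b := by
    have := Real.log_le_sub_one_of_pos (div_pos hb0 hc0)
    rw [Real.log_div hb0.ne' hc0.ne'] at this
    have e : (c - b) / c = 1 - b / c := by field_simp
    linarith
  have l3 : 0 < 1 + Real.log b := by linarith
  have l4 : 0 < 1 + Real.log c := by linarith
  rw [div_sub_div _ _ l3.ne' l4.ne', ← div_div]
  calc (c - b) / c / (1 + Real.log c) ^ 2
      ≤ (Real.log c - Real.log b) / (1 + Real.log c) ^ 2 := by gcongr
    _ ≤ (Real.log c - Real.log b) / ((1 + Real.log b) * (1 + Real.log c)) := by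
        apply div_le_div_of_nonneg_left (by linarith) (by positivity)
        nlinarith
    _ = _ := by ring_nf

/-- A bounded potential whose increments dominate the terms of `∑ 1 / (m (1 + log m) ^ 2)`. -/
noncomputable def logPotential (m : ℕ) : ℝ := if m = 0 then 0 else 2 - 1 / (1 + Real.log m)

theorem div_mul_sq_log_le_logPotential (m n : ℕ) :
    (n : ℝ) / ((m + n : ℕ) * (1 + Real.log (m + n : ℕ)) ^ 2) ≤
      logPotential (m + n) - logPotential m := by
  rcases Nat.eq_zero_or_pos n with rfl | hn
  · simp
  rcases Nat.eq_zero_or_pos m with rfl | hm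
  -- The first nonempty prefix can contribute up to `1`; the potential is `0` at `0` and at least
  -- `1` elsewhere to pay for it.
  · have hn1 : (1 : ℝ) ≤ n := by exact_mod_cast hn
    have l0 := Real.log_nonneg hn1
    simp only [logPotential, zero_add, hn.ne', if_false, if_true, sub_zero]
    have h1 : 1 / (1 + Real.log n) ≤ 1 := div_le_one_of_le₀ (by linarith) (by linarith)
    have h2 : (n : ℝ) / (n * (1 + Real.log n) ^ 2) ≤ 1 := by
      apply div_le_one_of_le₀ _ (by positivity)
      nlinarith [mul_nonneg (by linarith : (0 : ℝ) ≤ n) l0,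
        mul_nonneg (by linarith : (0 : ℝ) ≤ n) (sq_nonneg (Real.log n))]
    linarith
  · have hm1 : (1 : ℝ) ≤ m := by exact_mod_cast hm
    have hn0 : (0 : ℝ) ≤ n := by positivity
    have := sub_div_mul_sq_log_le hm1 (by linarith : (m : ℝ) ≤ m + n)
    have hmn : m + n ≠ 0 := by omega
    rw [logPotential, logPotential, if_neg hmn, if_neg hm.ne']
    push_cast
    rw [add_sub_cancel_left] at this
    linarith

theorem logPotential_le_two (m : ℕ) : logPotential m ≤ 2 := by
  unfold logPotential
  split_ifs with h
  · norm_num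
  · have : 0 ≤ Real.log m := Real.log_natCast_nonneg m
    have : 0 ≤ 1 / (1 + Real.log m) := by positivity
    linarith

theorem one_add_log_le_two_mul_posLog (x : ℝ) : 1 + Real.log x ≤ 2 * posLog x := by
  have h1 : Real.log x ≤ posLog x := le_max_left _ _
  linarith [one_le_posLog x]

/-- The terms telescope against `logPotential`, which is at most `2`. Since `1 + log m ≤ 2 posLog
m`, passing to `posLog` costs a factor `4`. Tasks without samples contribute `0`, also when the
whole prefix is empty. -/
theorem sum_div_mul_sq_posLog_le {N : ℕ} (b : Fin (N + 1) → ℕ) :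
    ∑ t, (b t : ℝ) / ((∑ s ∈ Finset.Iic t, b s : ℕ) *
      posLog (∑ s ∈ Finset.Iic t, b s : ℕ) ^ 2) ≤ 8 := by
  set b' : ℕ → ℕ := fun j => if h : j < N + 1 then b ⟨j, h⟩ else 0 with hb'
  have hbb : ∀ t : Fin (N + 1), b t = b' t := fun t => by simp only [hb', t.2, dif_pos, Fin.eta]
  have hsum : ∀ t : Fin (N + 1), ∑ s ∈ Finset.Iic t, b s = ∑ j ∈ Finset.range (t + 1), b' j := by
    intro t
    have e : Finset.range (t + 1) = (Finset.Iic t).map Fin.valEmbedding := by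
      rw [Fin.map_valEmbedding_Iic]
      ext j
      simp
    rw [e, Finset.sum_map]
    exact Finset.sum_congr rfl fun s _ => hbb s
  have hterm : ∀ t : Fin (N + 1), (b t : ℝ) / ((∑ s ∈ Finset.Iic t, b s : ℕ) *
      posLog (∑ s ∈ Finset.Iic t, b s : ℕ) ^ 2) ≤
      4 * (logPotential (∑ j ∈ Finset.range (t + 1), b' j) -
        logPotential (∑ j ∈ Finset.range t, b' j)) := by
    intro t
    rw [hsum, hbb]
    have h1 := div_mul_sq_log_le_logPotential (∑ j ∈ Finset.range t, b' j) (b' t)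
    rw [← Finset.sum_range_succ] at h1
    refine le_trans ?_ (mul_le_mul_of_nonneg_left h1 (by norm_num))
    rcases Nat.eq_zero_or_pos (b' t) with h0 | hpos
    · simp [h0]
    have hm : 0 < ∑ j ∈ Finset.range (t + 1), b' j := by
      rw [Finset.sum_range_succ]; omega
    set m := ∑ j ∈ Finset.range (t + 1), b' j
    have hm' : (0 : ℝ) < m := by exact_mod_cast hm
    have hl : 0 ≤ Real.log m := Real.log_natCast_nonneg m
    have h2 := one_add_log_le_two_mul_posLog (m : ℝ)
    have h3 : (1 + Real.log m) ^ 2 ≤ 4 * posLog m ^ 2 := by nlinarith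
    have hp := posLog_pos (m : ℝ)
    rw [← mul_div_assoc, div_le_div_iff₀ (by positivity) (by positivity)]
    have : (0 : ℝ) ≤ b' t * m := by positivity
    nlinarith [mul_le_mul_of_nonneg_left h3 this]
  refine (Finset.sum_le_sum fun t _ => hterm t).trans ?_
  rw [← Finset.mul_sum, Fin.sum_univ_eq_sum_range (fun i =>
    logPotential (∑ j ∈ Finset.range (i + 1), b' j) - logPotential (∑ j ∈ Finset.range i, b' j)),
    Finset.sum_range_sub (fun i => logPotential (∑ j ∈ Finset.range i, b' j))]
  have := logPotential_le_two (∑ j ∈ Finset.range (N + 1), b' j)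
  simp only [Finset.range_zero, Finset.sum_empty]
  have h0 : logPotential 0 = 0 := by simp [logPotential]
  linarith

end Telescoping

/-! ### Average exponents, information budget and comparison of rates. -/

section Rates

namespace Params

variable {N : ℕ} (M : Params N) {σ : Equiv.Perm (Fin (N + 1))}

theorem le_prefixSize (t : Fin (N + 1)) : M.n (σ t) ≤ M.prefixSize σ t :=
  Finset.single_le_sum (f := fun s => M.n (σ s)) (fun _ _ => Nat.zero_le _) (by simp)

/-- The average of an increasing sequence is at most its last term; this is how sorting enters the
lower bound. -/
theorem avgExponent_le (hσ : M.IsRanking σ) (t : Fin (N + 1)) :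
    M.avgExponent σ t ≤ M.exponent (σ t) := by
  unfold avgExponent
  apply ENNReal.div_le_of_le_mul
  rw [prefixSize, Nat.cast_sum, Finset.mul_sum]
  refine Finset.sum_le_sum fun s hs => ?_
  rw [mul_comm]
  exact mul_le_mul_left (hσ (Finset.mem_Iic.1 hs)) _

theorem one_le_avgExponent (hρ : ∀ t, 1 ≤ M.ρ t) {t : Fin (N + 1)} (ht : M.prefixSize σ t ≠ 0) :
    1 ≤ M.avgExponent σ t := by
  unfold avgExponent
  rw [ENNReal.le_div_iff_mul_le (Or.inl (by exact_mod_cast ht))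
    (Or.inl (ENNReal.natCast_ne_top _)), one_mul, prefixSize, Nat.cast_sum]
  exact Finset.sum_le_sum fun s _ => le_mul_of_one_le_right' (M.one_le_exponent hρ _)

theorem ratePower_nonneg (t : Fin (N + 1)) : 0 ≤ M.ratePower σ t :=
  mul_nonneg (div_nonneg zero_le_one (by linarith [M.β_le_one])) ENNReal.toReal_nonneg

theorem ratePower_le_one (hρ : ∀ t, 1 ≤ M.ρ t) {t : Fin (N + 1)} (ht : M.prefixSize σ t ≠ 0) :
    M.ratePower σ t ≤ 1 := by
  have h1 := toReal_inv_le_one (M.one_le_avgExponent hρ ht)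
  have h2 : 1 / (2 - M.β) ≤ 1 :=
    div_le_one_of_le₀ (by linarith [M.β_le_one]) (by linarith [M.β_le_one])
  exact mul_le_one₀ h2 ENNReal.toReal_nonneg h1

/-- As `ε ≤ 1`, replacing `ρ_(t)` by the smaller `ρ̄_t` can only increase the power, and `ratePower`
is the reciprocal of `(2 - β) ρ̄_t`. -/
theorem rpow_mul_exponent_le (hρ : ∀ t, 1 ≤ M.ρ t) (hσ : M.IsRanking σ) {ε B : ℝ} (hε : 0 < ε)
    (hε1 : ε ≤ 1) (hB : 0 < B) {t : Fin (N + 1)} (ht : M.prefixSize σ t ≠ 0)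
    (htop : M.exponent (σ t) ≠ ∞) (h : ε ≤ B ^ M.ratePower σ t) :
    ε ^ ((2 - M.β) * (M.exponent (σ t)).toReal) ≤ B := by
  have hβ : 0 < 2 - M.β := by linarith [M.β_le_one]
  have h1 := M.avgExponent_le hσ t
  have hR : (1 : ℝ) ≤ (M.avgExponent σ t).toReal := by
    simpa using ENNReal.toReal_mono (ne_top_of_le_ne_top htop h1) (M.one_le_avgExponent hρ ht)
  have h2 : (M.avgExponent σ t).toReal ≤ (M.exponent (σ t)).toReal := ENNReal.toReal_mono htop h1
  calc ε ^ ((2 - M.β) * (M.exponent (σ t)).toReal)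
      ≤ ε ^ ((2 - M.β) * (M.avgExponent σ t).toReal) :=
        Real.rpow_le_rpow_of_exponent_ge hε hε1 (by gcongr)
    _ ≤ (B ^ M.ratePower σ t) ^ ((2 - M.β) * (M.avgExponent σ t).toReal) :=
        Real.rpow_le_rpow hε.le h (by positivity)
    _ = B := by
        rw [← Real.rpow_mul hB.le, ratePower, ENNReal.toReal_inv]
        have : 1 / (2 - M.β) * (M.avgExponent σ t).toReal⁻¹ *
            ((2 - M.β) * (M.avgExponent σ t).toReal) = 1 := by
          field_simp
        rw [this, Real.rpow_one]

theorem information_le (hρ : ∀ t, 1 ≤ M.ρ t) (hσ : M.IsRanking σ) {ε c : ℝ} (hε : 0 < ε)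
    (hε1 : ε ≤ 1) (hc : 0 < c) {V : ℕ} (hV : 0 < V)
    (h : ∀ t, ENNReal.ofReal ε ≤ M.lowerTerm c V σ t) :
    ∑ t, (M.n t : ℝ) * (if M.exponent t = ∞ then 0 else
      ε ^ ((2 - M.β) * (M.exponent t).toReal)) ≤ 8 * (c * V) := by
  rw [← Equiv.sum_comp σ]
  have hV' : (0 : ℝ) < V := by exact_mod_cast hV
  calc _ ≤ ∑ t, c * V * ((M.n (σ t) : ℝ) / ((∑ s ∈ Finset.Iic t, M.n (σ s) : ℕ) *
      posLog (∑ s ∈ Finset.Iic t, M.n (σ s) : ℕ) ^ 2)) := by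
        refine Finset.sum_le_sum fun t _ => ?_
        rcases Nat.eq_zero_or_pos (M.n (σ t)) with h0 | hpos
        · simp [h0]
        have hm : 0 < M.prefixSize σ t := hpos.trans_le (M.le_prefixSize t)
        change _ ≤ c * V * ((M.n (σ t) : ℝ) / ((M.prefixSize σ t : ℕ) *
          posLog (M.prefixSize σ t : ℕ) ^ 2))
        have hm' : (0 : ℝ) < M.prefixSize σ t := by exact_mod_cast hm
        have hp := posLog_pos (M.prefixSize σ t : ℝ)
        split_ifs with htop
        · rw [mul_zero]; positivity
        · have h1 := h t
          rw [lowerTerm, orTop, if_neg hm.ne',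
            ENNReal.ofReal_le_ofReal_iff (by positivity)] at h1
          have h2 := M.rpow_mul_exponent_le hρ hσ hε hε1 (by positivity) hm.ne' htop h1
          calc _ ≤ _ := mul_le_mul_of_nonneg_left h2 (by positivity)
            _ = _ := by ring
    _ ≤ c * V * 8 := by
        rw [← Finset.mul_sum]
        exact mul_le_mul_of_nonneg_left (sum_div_mul_sq_posLog_le fun s => M.n (σ s))
          (by positivity)
    _ = _ := by ring

theorem lowerTerm_pos {c : ℝ} (hc : 0 < c) {V : ℕ} (hV : 0 < V) (t : Fin (N + 1)) :
    0 < M.lowerTerm c V σ t := by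
  rw [lowerTerm, orTop]
  split_ifs with h
  · simp
  · have hm : (0 : ℝ) < M.prefixSize σ t := by exact_mod_cast Nat.pos_of_ne_zero h
    have hV' : (0 : ℝ) < V := by exact_mod_cast hV
    have := posLog_pos (M.prefixSize σ t : ℝ)
    rw [ENNReal.ofReal_pos]
    positivity

/-- Exponents `ρ ≥ 1` force the power to be at most `1`. Hence `(V / 4) ^ e ≥ 1 / 4`, and the power
of `log²` is at most `log²`. -/
theorem minimaxLowerTerm_le (hρ : ∀ t, 1 ≤ M.ρ t) {V : ℕ} (hV : 0 < V) (t : Fin (N + 1)) :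
    M.minimaxLowerTerm σ t ≤ ENNReal.ofReal 4 * M.lowerTerm (1 / 4) V σ t := by
  rw [lowerTerm, minimaxLowerTerm, orTop, orTop]
  split_ifs with h
  · simp
  · rw [← ENNReal.ofReal_mul (by norm_num)]
    apply ENNReal.ofReal_le_ofReal
    have hm : (0 : ℝ) < M.prefixSize σ t := by exact_mod_cast Nat.pos_of_ne_zero h
    have hV' : (1 : ℝ) ≤ V := by exact_mod_cast hV
    have hp := posLog_pos (M.prefixSize σ t : ℝ)
    have hp1 := one_le_posLog (M.prefixSize σ t : ℝ)
    have e0 := M.ratePower_nonneg (σ := σ) t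
    have e1 := M.ratePower_le_one hρ h
    set m : ℝ := (M.prefixSize σ t : ℝ)
    set e := M.ratePower σ t
    have h1 : (1 / 4 : ℝ) ≤ (1 / 4 * V : ℝ) ^ e := by
      calc (1 / 4 : ℝ) = (1 / 4) ^ (1 : ℝ) := (Real.rpow_one _).symm
        _ ≤ (1 / 4 : ℝ) ^ e :=
            Real.rpow_le_rpow_of_exponent_ge (by norm_num) (by norm_num) e1
        _ ≤ _ := Real.rpow_le_rpow (by norm_num) (by linarith) e0
    have h2 : (posLog m ^ 2) ^ e ≤ posLog m ^ 2 := by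
      calc (posLog m ^ 2) ^ e ≤ (posLog m ^ 2) ^ (1 : ℝ) :=
            Real.rpow_le_rpow_of_exponent_le (one_le_pow₀ hp1) e1
        _ = _ := Real.rpow_one _
    rw [Real.div_rpow (by positivity) (by positivity), Real.mul_rpow hm.le (by positivity),
      Real.rpow_neg hm.le]
    have h3 : 0 < m ^ e := Real.rpow_pos_of_pos hm _
    have h4 : 0 < (posLog m ^ 2) ^ e := Real.rpow_pos_of_pos (by positivity) _
    calc (m ^ e)⁻¹ / posLog m ^ 2 = 4 * ((1 / 4) / (m ^ e * posLog m ^ 2)) := by field_simp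
      _ ≤ 4 * ((1 / 4 * V) ^ e / (m ^ e * (posLog m ^ 2) ^ e)) := by gcongr

theorem prefixSize_last : M.prefixSize σ (Fin.last N) = ∑ t, M.n t := by
  rw [prefixSize, ← Equiv.sum_comp σ]
  congr 1
  ext t
  simp [Fin.le_last]

theorem iInf_minimaxLowerTerm_le_one (hn : 0 < ∑ t, M.n t) :
    ⨅ t, M.minimaxLowerTerm σ t ≤ 1 := by
  refine (iInf_le _ (Fin.last N)).trans ?_
  have h : M.prefixSize σ (Fin.last N) ≠ 0 := by rw [M.prefixSize_last]; exact hn.ne'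
  rw [minimaxLowerTerm, orTop, if_neg h, ← ENNReal.ofReal_one]
  apply ENNReal.ofReal_le_ofReal
  have hm : (1 : ℝ) ≤ M.prefixSize σ (Fin.last N) := by
    exact_mod_cast Nat.one_le_iff_ne_zero.2 h
  have hp1 := one_le_posLog (M.prefixSize σ (Fin.last N) : ℝ)
  refine div_le_one_of_le₀ (le_trans ?_ (one_le_pow₀ hp1)) (by positivity)
  exact Real.rpow_le_one_of_one_le_of_nonpos hm (neg_nonpos.2 (M.ratePower_nonneg _))

end Params

end Rates

/-! ### The lower bounds in probability and in expectation. -/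

section LowerBounds

variable {X : Type u} [MeasurableSpace X] {H : Set (Classifier X)}

theorem pos_of_hasVCDim {X : Type u} {H : Set (Classifier X)} {V : ℕ} (hcard : 3 ≤ H.encard) (hV : HasVCDim H V) : 0 < V := by
  obtain ⟨h, hh, h', hh', hne⟩ := Set.one_lt_encard_iff_nontrivial.1
    (lt_of_lt_of_le (by norm_num : (1 : ℕ∞) < 3) hcard)
  obtain ⟨y, hy⟩ := Function.ne_iff.1 hne
  refine lt_of_lt_of_le one_pos (hV.2 {y} fun l => ?_)
  by_cases h1 : h y = l y
  · exact ⟨h, hh, by simpa using h1⟩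
  · refine ⟨h', hh', ?_⟩
    simp only [Finset.mem_singleton, forall_eq]
    revert h1 hy
    cases h y <;> cases h' y <;> cases l y <;> simp

theorem exists_mem_lower_bound (hH : ∀ h ∈ H, Measurable h) {V : ℕ} (hcard : 3 ≤ H.encard)
    (hV : HasVCDim H V) {N : ℕ} (M : Params N) {σ : Equiv.Perm (Fin (N + 1))}
    (hσ : M.IsRanking σ) (hρ : ∀ t, 1 ≤ M.ρ t) (A : MultiSample X M.n → Classifier X)
    (hA : IsLearner H A) :
    ∃ P : Fin (N + 1) → Measure (X × Bool), M.Mem H P ∧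
      1 / 50 ≤ sampleLaw M.n P
        {z | ENNReal.ofReal (1 / 200) * min 1 (⨅ t, M.lowerTerm (1 / 4) V σ t) <
          ENNReal.ofReal (excessRisk H (P (Fin.last N)) (A z))} := by
  have hV0 := pos_of_hasVCDim hcard hV
  obtain ⟨k, x₀, a, x, hk, hVk, hreal⟩ := exists_points_of_hasVCDim hcard hV
  have : Nonempty (Fin k) := ⟨⟨0, hk⟩⟩
  set E : ℝ≥0∞ := min 1 (⨅ t, M.lowerTerm (1 / 4) V σ t) with hE
  have hE1 : E ≤ 1 := min_le_left _ _
  have hEtop : E ≠ ∞ := ne_top_of_le_ne_top ENNReal.one_ne_top hE1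
  have hE0 : 0 < E := by
    obtain ⟨t, ht⟩ := exists_eq_ciInf_of_finite (f := fun t => M.lowerTerm (1 / 4) V σ t)
    refine lt_min one_pos ?_
    rw [← ht]
    exact M.lowerTerm_pos (by norm_num) hV0 t
  have hε : 0 < E.toReal := ENNReal.toReal_pos hE0.ne' hEtop
  have hε1 : E.toReal ≤ 1 := by simpa using ENNReal.toReal_mono ENNReal.one_ne_top hE1
  have hinfo := M.information_le hρ hσ hε hε1 (c := 1 / 4) (by norm_num) hV0 fun t => by
    rw [ENNReal.ofReal_toReal hEtop]
    exact (min_le_right _ _).trans (iInf_le _ t)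
  -- The constant `1 / 4` makes the information at most `8 · V / 4 = 2V`, which is at most `4k`.
  obtain ⟨P, hP, hprob⟩ := exists_mem_of_information_le hH hreal M hρ hε hε1 (hinfo.trans (by
    have : (V : ℝ) ≤ 2 * k := by exact_mod_cast hVk
    simp only [Fintype.card_fin]
    linarith)) A hA
  refine ⟨P, hP, hprob.trans (measure_mono fun z hz => ?_)⟩
  have hz' : E.toReal / 200 < excessRisk H (P (Fin.last N)) (A z) := hz
  change ENNReal.ofReal (1 / 200) * E < _
  rw [← ENNReal.ofReal_toReal hEtop, ← ENNReal.ofReal_mul (by norm_num),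
    ENNReal.ofReal_lt_ofReal_iff ((by positivity : 0 < E.toReal / 200).trans hz')]
  linarith

theorem measurable_excessRisk_learner (D : Measure (X × Bool)) [IsProbabilityMeasure D] {N : ℕ}
    {n : Fin (N + 1) → ℕ} {A : MultiSample X n → Classifier X} (hA : MeasurableLearner A) :
    Measurable fun z => excessRisk H D (A z) := by
  have h1 : Measurable fun p : MultiSample X n × (X × Bool) => A p.1 p.2.1 :=
    hA.comp (measurable_fst.prodMk (measurable_fst.comp measurable_snd))
  have h2 : MeasurableSet {p : MultiSample X n × (X × Bool) | A p.1 p.2.1 ≠ p.2.2} :=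
    (measurableSet_eq_fun h1 (measurable_snd.comp measurable_snd)).compl
  exact ((measurable_measure_prodMk_left (ν := D) h2).ennreal_toReal).sub_const _

theorem le_minimaxRisk (hH : ∀ h ∈ H, Measurable h) {V : ℕ} (hcard : 3 ≤ H.encard)
    (hV : HasVCDim H V) {N : ℕ} (M : Params N) {σ : Equiv.Perm (Fin (N + 1))}
    (hσ : M.IsRanking σ) (hρ : ∀ t, 1 ≤ M.ρ t) (hn : 0 < ∑ t, M.n t) :
    ENNReal.ofReal (1 / 40000) * (⨅ t, M.minimaxLowerTerm σ t) ≤ M.minimaxRisk H := by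
  have hV0 := pos_of_hasVCDim hcard hV
  refine le_iInf fun ⟨A, hA, hAm⟩ => ?_
  obtain ⟨P, hP, hprob⟩ := exists_mem_lower_bound hH hcard hV M hσ hρ A hA
  refine le_trans ?_ (le_iSup _ (⟨P, hP⟩ : {P // M.Mem H P}))
  have := hP.prob (Fin.last N)
  have hmeas : Measurable fun z => ENNReal.ofReal (excessRisk H (P (Fin.last N)) (A z)) :=
    (measurable_excessRisk_learner _ hAm).ennreal_ofReal
  -- Markov's inequality at the level of the probability bound; `40000 = 4 · 200 · 50`.
  refine le_trans ?_ (mul_meas_ge_le_lintegral hmeas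
    (ENNReal.ofReal (1 / 200) * min 1 (⨅ t, M.lowerTerm (1 / 4) V σ t)))
  have h1 : (1 / 50 : ℝ≥0∞) ≤ sampleLaw M.n P {z |
      ENNReal.ofReal (1 / 200) * min 1 (⨅ t, M.lowerTerm (1 / 4) V σ t) ≤
        ENNReal.ofReal (excessRisk H (P (Fin.last N)) (A z))} :=
    hprob.trans (measure_mono fun z hz => by
      simp only [Set.mem_ofPred_eq] at hz ⊢
      exact hz.le)
  refine le_trans ?_ (mul_le_mul_right h1 _)
  have h2 : ⨅ t, M.minimaxLowerTerm σ t ≤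
      ENNReal.ofReal 4 * min 1 (⨅ t, M.lowerTerm (1 / 4) V σ t) := by
    rcases min_choice 1 (⨅ t, M.lowerTerm (1 / 4) V σ t) with h | h <;> rw [h]
    · refine (M.iInf_minimaxLowerTerm_le_one hn).trans ?_
      rw [mul_one, ← ENNReal.ofReal_one]
      exact ENNReal.ofReal_le_ofReal (by norm_num)
    · rw [ENNReal.mul_iInf_of_ne (by simp) (by simp)]
      exact iInf_mono fun t => M.minimaxLowerTerm_le hρ hV0 t
  have h50 : (1 / 50 : ℝ≥0∞) = ENNReal.ofReal (1 / 50) := by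
    rw [ENNReal.ofReal_div_of_pos (by norm_num)]; simp
  calc _ ≤ ENNReal.ofReal (1 / 40000) *
        (ENNReal.ofReal 4 * min 1 (⨅ t, M.lowerTerm (1 / 4) V σ t)) := mul_le_mul_right h2 _
    _ = _ := by
        rw [h50, mul_right_comm, ← ENNReal.ofReal_mul (by norm_num), ← mul_assoc,
          ← ENNReal.ofReal_mul (by norm_num)]
        norm_num

end LowerBounds

/-! ### Hoeffding's bound for random signs. -/

section Rademacher

/-- The sign attached to a bit. -/
def bitSign (b : Bool) : ℝ := if b then -1 else 1

/-- Hoeffding's inequality for Rademacher sums, as a counting bound. -/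
theorem card_rademacher_ge_le {ι : Type*} [Fintype ι] [DecidableEq ι] (a : ι → ℝ) {s B : ℝ}
    (hs : 0 ≤ s) (hB : 0 < B) (ha : ∑ i, a i ^ 2 ≤ B) :
    ((Finset.univ.filter fun e : ι → Bool => s ≤ ∑ i, bitSign (e i) * a i).card : ℝ) ≤
      2 ^ Fintype.card ι * Real.exp (-(s ^ 2 / (2 * B))) := by
  -- Chernoff's method: this `l` minimizes `l² B / 2 - l s`.
  set l : ℝ := s / B
  have hl : 0 ≤ l := by positivity
  have h1 : ∑ e : ι → Bool, Real.exp (l * ∑ i, bitSign (e i) * a i) ≤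
      2 ^ Fintype.card ι * Real.exp (l ^ 2 * B / 2) := by
    have e1 : ∀ e : ι → Bool, Real.exp (l * ∑ i, bitSign (e i) * a i) =
        ∏ i, Real.exp (l * (bitSign (e i) * a i)) := fun e => by
      rw [Finset.mul_sum, Real.exp_sum]
    simp_rw [e1]
    rw [← Fintype.prod_sum fun (i : ι) (b : Bool) => Real.exp (l * (bitSign b * a i))]
    calc ∏ i, ∑ b : Bool, Real.exp (l * (bitSign b * a i))
        ≤ ∏ i, (2 * Real.exp ((l * a i) ^ 2 / 2)) := by
          refine Finset.prod_le_prod (fun i _ => by positivity) fun i _ => ?_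
          have := Real.cosh_le_exp_half_sq (l * a i)
          rw [Real.cosh_eq] at this
          simp only [Fintype.sum_bool, bitSign, if_true, Bool.false_eq_true, if_false]
          have e2 : l * (-1 * a i) = -(l * a i) := by ring
          have e3 : l * (1 * a i) = l * a i := by ring
          rw [e2, e3]
          linarith
      _ = 2 ^ Fintype.card ι * Real.exp (∑ i, (l * a i) ^ 2 / 2) := by
          rw [Finset.prod_mul_distrib, Real.exp_sum]
          simp
      _ ≤ _ := by
          gcongr
          rw [← Finset.sum_div]
          simp_rw [mul_pow]
          rw [← Finset.mul_sum]
          gcongr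
  have h2 : ((Finset.univ.filter fun e : ι → Bool => s ≤ ∑ i, bitSign (e i) * a i).card : ℝ) *
      Real.exp (l * s) ≤ ∑ e : ι → Bool, Real.exp (l * ∑ i, bitSign (e i) * a i) := by
    rw [← nsmul_eq_mul]
    refine (Finset.card_nsmul_le_sum _ (fun e : ι → Bool =>
      Real.exp (l * ∑ i, bitSign (e i) * a i)) _ fun e he => ?_).trans
      (Finset.sum_le_sum_of_subset_of_nonneg (Finset.filter_subset _ _)
        fun _ _ _ => (Real.exp_pos _).le)
    have := (Finset.mem_filter.1 he).2
    exact Real.exp_le_exp.2 (mul_le_mul_of_nonneg_left this hl)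
  have h3 := h2.trans h1
  have e4 : -(s ^ 2 / (2 * B)) = l ^ 2 * B / 2 - l * s := by
    simp only [l]; field_simp; ring
  rw [e4, Real.exp_sub, ← mul_div_assoc, le_div_iff₀ (Real.exp_pos _)]
  exact h3

end Rademacher

/-! ### Excess losses and their variance proxy. -/

section Losses

variable {X : Type u}

/-- The loss of `h` in excess of the loss of `hs`. -/
noncomputable def excessLoss (hs h : Classifier X) (y : X × Bool) : ℝ :=
  (if h y.1 ≠ y.2 then 1 else 0) - if hs y.1 ≠ y.2 then 1 else 0

/-- The indicator of the event that `h` and `hs` disagree. -/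
noncomputable def disagreeInd (hs h : Classifier X) (y : X × Bool) : ℝ :=
  if h y.1 ≠ hs y.1 then 1 else 0

variable (hs h : Classifier X) (y y' : X × Bool)

theorem disagreeInd_nonneg : 0 ≤ disagreeInd hs h y := by
  unfold disagreeInd; split_ifs <;> norm_num

theorem disagreeInd_le_one : disagreeInd hs h y ≤ 1 := by
  unfold disagreeInd; split_ifs <;> norm_num

theorem abs_excessLoss_le : |excessLoss hs h y| ≤ disagreeInd hs h y := by
  unfold excessLoss disagreeInd
  cases h y.1 <;> cases hs y.1 <;> cases y.2 <;> simp

/-- Two losses differ only where the classifiers do, so disagreement serves as a variance proxy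
throughout. -/
theorem sq_excessLoss_le : excessLoss hs h y ^ 2 ≤ disagreeInd hs h y := by
  have h1 := abs_excessLoss_le hs h y
  have h2 := disagreeInd_le_one hs h y
  have h3 := abs_nonneg (excessLoss hs h y)
  rw [← sq_abs]
  nlinarith

theorem sq_sub_excessLoss_le : (excessLoss hs h y' - excessLoss hs h y) ^ 2 ≤
    2 * (disagreeInd hs h y + disagreeInd hs h y') := by
  nlinarith [sq_excessLoss_le hs h y, sq_excessLoss_le hs h y',
    sq_nonneg (excessLoss hs h y' + excessLoss hs h y)]

theorem sq_sub_disagreeInd_le : (disagreeInd hs h y - disagreeInd hs h y') ^ 2 ≤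
    disagreeInd hs h y + disagreeInd hs h y' := by
  nlinarith [disagreeInd_nonneg hs h y, disagreeInd_nonneg hs h y',
    disagreeInd_le_one hs h y, disagreeInd_le_one hs h y',
    mul_nonneg (disagreeInd_nonneg hs h y) (disagreeInd_nonneg hs h y')]

end Losses

/-! ### Exchanging a sample with its ghost. -/

section Swapping

variable {ι Y : Type*}

/-- Exchange the entries of a pair of samples at the coordinates selected by `e`. -/
def swapAt (e : ι → Bool) (q : (ι → Y) × (ι → Y)) : (ι → Y) × (ι → Y) :=
  (fun i => if e i then q.2 i else q.1 i, fun i => if e i then q.1 i else q.2 i)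

/-- The two entries at coordinate `i` are independent with the same law `P i`; the laws may differ
between coordinates. The proof regroups the two samples into a product of pairs. -/
theorem measurePreserving_swapAt [Fintype ι] [MeasurableSpace Y] (P : ι → Measure Y)
    [∀ i, IsProbabilityMeasure (P i)] (e : ι → Bool) :
    MeasurePreserving (swapAt e) ((Measure.pi P).prod (Measure.pi P))
      ((Measure.pi P).prod (Measure.pi P)) := by
  have h1 := measurePreserving_arrowProdEquivProdArrow Y Y ι P P
  have h2 : MeasurePreserving (fun (a : ι → Y × Y) i => (if e i then Prod.swap else id) (a i))
      (Measure.pi fun i => (P i).prod (P i)) (Measure.pi fun i => (P i).prod (P i)) :=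
    measurePreserving_pi (f := fun i => if e i then Prod.swap else id) _ _ fun i => by
      split_ifs
      · exact Measure.measurePreserving_swap
      · exact MeasurePreserving.id _
  have h3 := (h1.comp h2).comp (h1.symm _)
  convert h3 using 1
  funext q
  ext i
  · simp only [swapAt, Function.comp]
    by_cases h : e i <;> simp [h, MeasurableEquiv.arrowProdEquivProdArrow,
      Equiv.arrowProdEquivProdArrow]
  · simp only [swapAt, Function.comp]
    by_cases h : e i <;> simp [h, MeasurableEquiv.arrowProdEquivProdArrow,
      Equiv.arrowProdEquivProdArrow]

theorem sum_swapAt_snd_sub_fst (e : ι → Bool) (q : (ι → Y) × (ι → Y)) (J : Finset ι)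
    (φ : Y → ℝ) :
    ∑ i ∈ J, φ ((swapAt e q).2 i) - ∑ i ∈ J, φ ((swapAt e q).1 i) =
      ∑ i ∈ J, bitSign (e i) * (φ (q.2 i) - φ (q.1 i)) := by
  rw [← Finset.sum_sub_distrib]
  refine Finset.sum_congr rfl fun i _ => ?_
  by_cases h : e i <;> simp [swapAt, bitSign, h]

theorem sum_swapAt_fst_add_snd (e : ι → Bool) (q : (ι → Y) × (ι → Y)) (J : Finset ι)
    (φ : Y → ℝ) :
    ∑ i ∈ J, φ ((swapAt e q).1 i) + ∑ i ∈ J, φ ((swapAt e q).2 i) =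
      ∑ i ∈ J, (φ (q.1 i) + φ (q.2 i)) := by
  rw [← Finset.sum_add_distrib]
  refine Finset.sum_congr rfl fun i _ => ?_
  by_cases h : e i <;> simp [swapAt, h, add_comm]

end Swapping

/-! ### Random swaps for a fixed classifier. -/

section Symmetrization

variable {X : Type u} {ι : Type*}

/-- The event, for a sample `q.1` and a ghost sample `q.2`, that `h` looks no worse than `hs` on the
sample but clearly worse on the ghost sample, relative to its disagreements with `hs` there. -/
def GhostDeviation (J : Finset ι) (R L : ℝ) (hs h : Classifier X)
    (q : (ι → X × Bool) × (ι → X × Bool)) : Prop :=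
  ∑ i ∈ J, excessLoss hs h (q.1 i) ≤ 0 ∧ R / 2 ≤ ∑ i ∈ J, excessLoss hs h (q.2 i) ∧
    3 * L * ∑ i ∈ J, disagreeInd hs h (q.2 i) ≤ (∑ i ∈ J, excessLoss hs h (q.2 i)) ^ 2

-- Let `T` be the number of disagreements on both samples, which no swap changes, and let `D` and
-- `S` be disagreements and excess loss on the ghost sample. If `T ≤ 3D`, then `S² ≥ 3LD ≥ LT`, a
-- signed sum of excess losses above `√(LT)`. Otherwise disagreements are unbalanced by at least `T
-- / 3`. Hoeffding's bound gives `exp (-L / 4)` and `exp (-T / 18)`, where `T ≥ R / 2` because `S ≤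
-- D ≤ T`.
open Classical in
theorem card_ghostDeviation_le [Fintype ι] (J : Finset ι) {R L : ℝ} (hR : 0 < R) (hL : 0 < L)
    (hs h : Classifier X) (q : (ι → X × Bool) × (ι → X × Bool)) :
    ((Finset.univ.filter fun e : ι → Bool =>
      GhostDeviation J R L hs h (swapAt e q)).card : ℝ) ≤
      2 ^ Fintype.card ι * (Real.exp (-(R / 36)) + Real.exp (-(L / 4))) := by
  set T : ℝ := ∑ i ∈ J, (disagreeInd hs h (q.1 i) + disagreeInd hs h (q.2 i)) with hT
  have hT0 : 0 ≤ T := Finset.sum_nonneg fun i _ =>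
    add_nonneg (disagreeInd_nonneg _ _ _) (disagreeInd_nonneg _ _ _)
  have hST : ∀ e, GhostDeviation J R L hs h (swapAt e q) → R / 2 ≤ T ∧
      ∑ i ∈ J, excessLoss hs h ((swapAt e q).2 i) ≤
        ∑ i ∈ J, disagreeInd hs h ((swapAt e q).2 i) := by
    rintro e ⟨-, h2, -⟩
    have h3 : ∑ i ∈ J, excessLoss hs h ((swapAt e q).2 i) ≤
        ∑ i ∈ J, disagreeInd hs h ((swapAt e q).2 i) :=
      Finset.sum_le_sum fun i _ => (le_abs_self _).trans (abs_excessLoss_le _ _ _)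
    refine ⟨?_, h3⟩
    have h4 := sum_swapAt_fst_add_snd e q J (disagreeInd hs h)
    have h5 : 0 ≤ ∑ i ∈ J, disagreeInd hs h ((swapAt e q).1 i) :=
      Finset.sum_nonneg fun i _ => disagreeInd_nonneg _ _ _
    rw [hT, ← h4]
    linarith
  rcases lt_or_ge T (R / 2) with hTR | hTR
  · have : (Finset.univ.filter fun e : ι → Bool =>
        GhostDeviation J R L hs h (swapAt e q)) = ∅ :=
      Finset.filter_eq_empty_iff.2 fun e _ he => absurd (hST e he).1 (not_le.2 hTR)
    rw [this]
    simp only [Finset.card_empty, Nat.cast_zero]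
    positivity
  have hTpos : 0 < T := by linarith
  have hsumJ : ∀ (e : ι → Bool) (φ : ι → ℝ), ∑ i ∈ J, bitSign (e i) * φ i =
      ∑ i, bitSign (e i) * (if i ∈ J then φ i else 0) := by
    intro e φ
    simp [mul_ite, Finset.sum_ite_mem]
  have hsqJ : ∀ φ : ι → ℝ, ∑ i, (if i ∈ J then φ i else 0) ^ 2 = ∑ i ∈ J, φ i ^ 2 := by
    intro φ
    simp [ite_pow, Finset.sum_ite_mem]
  have c1 := card_rademacher_ge_le
    (fun i => if i ∈ J then disagreeInd hs h (q.1 i) - disagreeInd hs h (q.2 i) else 0)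
    (s := T / 3) (B := T) (by positivity) hTpos (by
      rw [hsqJ, hT]
      exact Finset.sum_le_sum fun i _ => sq_sub_disagreeInd_le _ _ _ _)
  have c2 := card_rademacher_ge_le
    (fun i => if i ∈ J then excessLoss hs h (q.2 i) - excessLoss hs h (q.1 i) else 0)
    (s := √(L * T)) (B := 2 * T) (by positivity) (by positivity) (by
      rw [hsqJ, hT, Finset.mul_sum]
      exact Finset.sum_le_sum fun i _ => sq_sub_excessLoss_le _ _ _ _)
  have e1 : Real.exp (-((T / 3) ^ 2 / (2 * T))) ≤ Real.exp (-(R / 36)) := by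
    apply Real.exp_le_exp.2
    have : (T / 3) ^ 2 / (2 * T) = T / 18 := by field_simp; ring
    rw [this]
    linarith
  have e2 : √(L * T) ^ 2 / (2 * (2 * T)) = L / 4 := by
    rw [Real.sq_sqrt (by positivity)]; field_simp; ring
  rw [e2] at c2
  have hsub : (Finset.univ.filter fun e : ι → Bool =>
      GhostDeviation J R L hs h (swapAt e q)) ⊆
      (Finset.univ.filter fun e : ι → Bool => T / 3 ≤ ∑ i, bitSign (e i) *
        (if i ∈ J then disagreeInd hs h (q.1 i) - disagreeInd hs h (q.2 i) else 0)) ∪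
      (Finset.univ.filter fun e : ι → Bool => √(L * T) ≤ ∑ i, bitSign (e i) *
        (if i ∈ J then excessLoss hs h (q.2 i) - excessLoss hs h (q.1 i) else 0)) := by
    intro e he
    have hd := (Finset.mem_filter.1 he).2
    obtain ⟨-, hSD⟩ := hST e hd
    obtain ⟨d1, d2, d3⟩ := hd
    have s1 := sum_swapAt_fst_add_snd e q J (disagreeInd hs h)
    have s2 := sum_swapAt_snd_sub_fst e q J (disagreeInd hs h)
    have s3 := sum_swapAt_snd_sub_fst e q J (excessLoss hs h)
    rw [Finset.mem_union, Finset.mem_filter, Finset.mem_filter, ← hsumJ e, ← hsumJ e]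
    rw [← hT] at s1
    rcases le_or_gt T (3 * ∑ i ∈ J, disagreeInd hs h ((swapAt e q).2 i)) with hc | hc
    · right
      refine ⟨Finset.mem_univ _, ?_⟩
      rw [← s3]
      have : √(L * T) ≤ ∑ i ∈ J, excessLoss hs h ((swapAt e q).2 i) := by
        apply Real.sqrt_le_iff.2 ⟨by linarith, ?_⟩
        nlinarith
      linarith
    · left
      refine ⟨Finset.mem_univ _, ?_⟩
      have : ∑ i ∈ J, bitSign (e i) * (disagreeInd hs h (q.1 i) - disagreeInd hs h (q.2 i)) =
          -∑ i ∈ J, bitSign (e i) * (disagreeInd hs h (q.2 i) - disagreeInd hs h (q.1 i)) := by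
        rw [← Finset.sum_neg_distrib]
        exact Finset.sum_congr rfl fun i _ => by ring
      rw [this, ← s2]
      linarith
  have hcard := (Finset.card_le_card hsub).trans (Finset.card_union_le _ _)
  have hcard' := (Nat.cast_le (α := ℝ)).2 hcard
  rw [Nat.cast_add] at hcard'
  refine hcard'.trans ?_
  rw [mul_add]
  refine add_le_add (c1.trans ?_) c2
  exact mul_le_mul_of_nonneg_left e1 (by positivity)

end Symmetrization

/-! ### Sauer-Shelah and the union bound over traces. -/

section Patterns

variable {X : Type u} {H : Set (Classifier X)}

/-- The Sauer-Shelah bound on the cardinality of a class of VC dimension `V` on `n` points. -/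
def growthBound (n V : ℕ) : ℕ := ∑ k ∈ Finset.Iic V, n.choose k

theorem growthBound_mono {n n' : ℕ} (h : n ≤ n') (V : ℕ) : growthBound n V ≤ growthBound n' V :=
  Finset.sum_le_sum fun _ _ => Nat.choose_le_choose _ h

open Classical in
/-- The traces of `H` on a finite set of points. -/
noncomputable def traces (H : Set (Classifier X)) (Q : Finset X) : Finset (Finset Q) :=
  Finset.univ.filter fun T => ∃ h ∈ H, ∀ p : Q, p ∈ T ↔ h p = true

theorem mem_traces {Q : Finset X} {T : Finset Q} :
    T ∈ traces H Q ↔ ∃ h ∈ H, ∀ p : Q, p ∈ T ↔ h p = true := by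
  simp [traces]

theorem card_traces_le {V : ℕ} (hV : HasVCDim H V) (Q : Finset X) :
    (traces H Q).card ≤ growthBound Q.card V := by
  classical
  refine (Finset.card_le_card_shatterer _).trans (Finset.card_shatterer_le_sum_vcDim.trans ?_)
  rw [Fintype.card_coe]
  refine Finset.sum_le_sum_of_subset (Finset.Iic_subset_Iic.2 (Finset.sup_le fun s hs => ?_))
  rw [Finset.mem_shatterer] at hs
  rw [← Finset.card_map (Function.Embedding.subtype _)]
  refine hV.2 _ fun y => ?_
  obtain ⟨u, hu, hsu⟩ := hs (Finset.filter_subset (fun p : Q => y p = true) s)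
  obtain ⟨h, hh, hhu⟩ := mem_traces.1 hu
  refine ⟨h, hh, fun x hx => ?_⟩
  obtain ⟨p, hp, rfl⟩ := Finset.mem_map.1 hx
  have h1 : p ∈ s ∩ u ↔ y p = true := by rw [hsu, Finset.mem_filter]; simp [hp]
  rw [Finset.mem_inter, hhu p] at h1
  simp only [hp, true_and] at h1
  exact Bool.eq_iff_iff.2 h1

variable {ι : Type*}

/-- The event depends on the classifier only through its values on the two samples, so finitely many
traces suffice. -/
theorem GhostDeviation.congr {J : Finset ι} {R L : ℝ} {hs h h' : Classifier X}
    {q : (ι → X × Bool) × (ι → X × Bool)} (h1 : ∀ i ∈ J, h (q.1 i).1 = h' (q.1 i).1)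
    (h2 : ∀ i ∈ J, h (q.2 i).1 = h' (q.2 i).1) (hd : GhostDeviation J R L hs h q) :
    GhostDeviation J R L hs h' q := by
  unfold GhostDeviation at *
  have e1 : ∑ i ∈ J, excessLoss hs h' (q.1 i) = ∑ i ∈ J, excessLoss hs h (q.1 i) :=
    Finset.sum_congr rfl fun i hi => by simp only [excessLoss, h1 i hi]
  have e2 : ∑ i ∈ J, excessLoss hs h' (q.2 i) = ∑ i ∈ J, excessLoss hs h (q.2 i) :=
    Finset.sum_congr rfl fun i hi => by simp only [excessLoss, h2 i hi]
  have e3 : ∑ i ∈ J, disagreeInd hs h' (q.2 i) = ∑ i ∈ J, disagreeInd hs h (q.2 i) :=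
    Finset.sum_congr rfl fun i hi => by simp only [disagreeInd, h2 i hi]
  rwa [e1, e2, e3]

open Classical in
theorem card_exists_ghostDeviation_le [Fintype ι] {V : ℕ} (hV : HasVCDim H V) (J : Finset ι)
    {R L : ℝ} (hR : 0 < R) (hL : 0 < L) (hs : Classifier X)
    (q : (ι → X × Bool) × (ι → X × Bool)) :
    ((Finset.univ.filter fun e : ι → Bool =>
      ∃ h ∈ H, GhostDeviation J R L hs h (swapAt e q)).card : ℝ) ≤
      growthBound (2 * J.card) V *
        (2 ^ Fintype.card ι * (Real.exp (-(R / 36)) + Real.exp (-(L / 4)))) := by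
  -- Swapping permutes the points of both samples, so one set `Q` serves all `e`.
  set Q : Finset X := J.image (fun i => (q.1 i).1) ∪ J.image (fun i => (q.2 i).1) with hQ
  have hQcard : Q.card ≤ 2 * J.card := by
    refine (Finset.card_union_le _ _).trans ?_
    have := Finset.card_image_le (s := J) (f := fun i => (q.1 i).1)
    have := Finset.card_image_le (s := J) (f := fun i => (q.2 i).1)
    omega
  have hrep : ∀ T : Finset Q, ∃ h : Classifier X, T ∈ traces H Q →
      ∀ p : Q, p ∈ T ↔ h p = true := fun T => by
    by_cases hT : T ∈ traces H Q
    · obtain ⟨h, -, hh⟩ := mem_traces.1 hT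
      exact ⟨h, fun _ => hh⟩
    · exact ⟨hs, fun h => absurd h hT⟩
  choose rep hrep using hrep
  have hsub : (Finset.univ.filter fun e : ι → Bool =>
      ∃ h ∈ H, GhostDeviation J R L hs h (swapAt e q)) ⊆
      (traces H Q).biUnion fun T => Finset.univ.filter fun e : ι → Bool =>
        GhostDeviation J R L hs (rep T) (swapAt e q) := by
    intro e he
    obtain ⟨-, h, hh, hd⟩ := Finset.mem_filter.1 he
    set T : Finset Q := Finset.univ.filter fun p : Q => h p = true with hT
    have hmem : T ∈ traces H Q := mem_traces.2 ⟨h, hh, fun p => by simp [hT]⟩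
    have hag : ∀ p ∈ Q, h p = rep T p := fun p hp => by
      have := hrep T hmem ⟨p, hp⟩
      rw [hT, Finset.mem_filter] at this
      simp only [Finset.mem_univ, true_and] at this
      exact Bool.eq_iff_iff.2 this
    have hq1 : ∀ i ∈ J, (q.1 i).1 ∈ Q := fun i hi =>
      Finset.mem_union_left _ (Finset.mem_image_of_mem _ hi)
    have hq2 : ∀ i ∈ J, (q.2 i).1 ∈ Q := fun i hi =>
      Finset.mem_union_right _ (Finset.mem_image_of_mem (fun i => (q.2 i).1) hi)
    refine Finset.mem_biUnion.2 ⟨T, hmem, Finset.mem_filter.2 ⟨Finset.mem_univ _, ?_⟩⟩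
    refine hd.congr (fun i hi => hag _ ?_) fun i hi => hag _ ?_
    · by_cases hb : e i <;> simp [swapAt, hb, hq1 i hi, hq2 i hi]
    · by_cases hb : e i <;> simp [swapAt, hb, hq1 i hi, hq2 i hi]
  have h1 := (Finset.card_le_card hsub).trans Finset.card_biUnion_le
  have h2 := (Nat.cast_le (α := ℝ)).2 h1
  refine h2.trans ?_
  rw [Nat.cast_sum]
  refine (Finset.sum_le_sum fun T _ => card_ghostDeviation_le J hR hL hs (rep T) q).trans ?_
  rw [Finset.sum_const, nsmul_eq_mul]
  have h3 : ((traces H Q).card : ℝ) ≤ growthBound (2 * J.card) V := by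
    exact_mod_cast (card_traces_le hV Q).trans (growthBound_mono hQcard V)
  exact mul_le_mul_of_nonneg_right h3 (by positivity)

end Patterns

/-! ### The localized deviation bound for a measurable selection. -/

section Concentration

variable {X : Type u} [MeasurableSpace X] {ι : Type*}

theorem measurable_ite_eq {Ω : Type*} [MeasurableSpace Ω] {f g : Ω → Bool} (hf : Measurable f)
    (hg : Measurable g) : Measurable fun ω => if f ω ≠ g ω then (1 : ℝ) else 0 :=
  Measurable.ite (measurableSet_eq_fun hf hg).compl measurable_const measurable_const

theorem measurable_excessLoss {hs h : Classifier X} (hms : Measurable hs) (hm : Measurable h) :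
    Measurable (excessLoss hs h) :=
  (measurable_ite_eq (hm.comp measurable_fst) measurable_snd).sub
    (measurable_ite_eq (hms.comp measurable_fst) measurable_snd)

theorem measurable_disagreeInd {hs h : Classifier X} (hms : Measurable hs) (hm : Measurable h) :
    Measurable (disagreeInd hs h) :=
  measurable_ite_eq (hm.comp measurable_fst) (hms.comp measurable_fst)

theorem measurableSet_ghostDeviation (J : Finset ι) (R L : ℝ) {hs : Classifier X}
    (hms : Measurable hs) {A : (ι → X × Bool) → Classifier X}
    (hA : Measurable fun p : (ι → X × Bool) × X => A p.1 p.2) :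
    MeasurableSet {q : (ι → X × Bool) × (ι → X × Bool) | GhostDeviation J R L hs (A q.1) q} := by
  have m1 : ∀ i, Measurable fun q : (ι → X × Bool) × (ι → X × Bool) => q.1 i := fun i =>
    (measurable_pi_apply i).comp measurable_fst
  have m2 : ∀ i, Measurable fun q : (ι → X × Bool) × (ι → X × Bool) => q.2 i := fun i =>
    (measurable_pi_apply i).comp measurable_snd
  have a1 : ∀ i, Measurable fun q : (ι → X × Bool) × (ι → X × Bool) => A q.1 (q.1 i).1 :=
    fun i => hA.comp (measurable_fst.prodMk (measurable_fst.comp (m1 i)))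
  have a2 : ∀ i, Measurable fun q : (ι → X × Bool) × (ι → X × Bool) => A q.1 (q.2 i).1 :=
    fun i => hA.comp (measurable_fst.prodMk (measurable_fst.comp (m2 i)))
  have s1 : Measurable fun q : (ι → X × Bool) × (ι → X × Bool) =>
      ∑ i ∈ J, excessLoss hs (A q.1) (q.1 i) :=
    Finset.measurable_fun_sum _ fun i _ =>
      (measurable_ite_eq (a1 i) (measurable_snd.comp (m1 i))).sub
        (measurable_ite_eq (hms.comp (measurable_fst.comp (m1 i))) (measurable_snd.comp (m1 i)))
  have s2 : Measurable fun q : (ι → X × Bool) × (ι → X × Bool) =>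
      ∑ i ∈ J, excessLoss hs (A q.1) (q.2 i) :=
    Finset.measurable_fun_sum _ fun i _ =>
      (measurable_ite_eq (a2 i) (measurable_snd.comp (m2 i))).sub
        (measurable_ite_eq (hms.comp (measurable_fst.comp (m2 i))) (measurable_snd.comp (m2 i)))
  have s3 : Measurable fun q : (ι → X × Bool) × (ι → X × Bool) =>
      ∑ i ∈ J, disagreeInd hs (A q.1) (q.2 i) :=
    Finset.measurable_fun_sum _ fun i _ =>
      measurable_ite_eq (a2 i) (hms.comp (measurable_fst.comp (m2 i)))
  exact (measurableSet_le s1 measurable_const).inter ((measurableSet_le measurable_const s2).inter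
    (measurableSet_le (s3.const_mul _) (s2.pow_const 2)))

variable [Fintype ι] {P : ι → Measure (X × Bool)} [∀ i, IsProbabilityMeasure (P i)]

theorem integrable_of_abs_le_one {Ω : Type*} [MeasurableSpace Ω] {μ : Measure Ω}
    [IsProbabilityMeasure μ] {f : Ω → ℝ} (hf : Measurable f) (h : ∀ ω, |f ω| ≤ 1) :
    MemLp f 2 μ :=
  MemLp.of_bound hf.aestronglyMeasurable 1 (Filter.Eventually.of_forall h)

/-- A ghost sample reveals a large excess risk with probability at least one half. -/
theorem half_le_prob_ghost {J : Finset ι} {L F : ℝ} {hs h : Classifier X} (hms : Measurable hs)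
    (hm : Measurable h) (hL : 1 ≤ L) (hF : 0 < F)
    (hFe : F = ∑ i ∈ J, ∫ y, excessLoss hs h y ∂P i)
    (hnoise : 48 * L * ∑ i ∈ J, ∫ y, disagreeInd hs h y ∂P i ≤ F ^ 2) :
    1 / 2 ≤ Measure.pi P {z | F / 2 ≤ ∑ i ∈ J, excessLoss hs h (z i) ∧
      3 * L * ∑ i ∈ J, disagreeInd hs h (z i) ≤ (∑ i ∈ J, excessLoss hs h (z i)) ^ 2} := by
  classical
  set G : ℝ := ∑ i ∈ J, ∫ y, disagreeInd hs h y ∂P i with hG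
  have mf := measurable_excessLoss hms hm
  have mg := measurable_disagreeInd hms hm
  have bf : ∀ y, |excessLoss hs h y| ≤ 1 := fun y =>
    (abs_excessLoss_le hs h y).trans (disagreeInd_le_one hs h y)
  have bg : ∀ y, |disagreeInd hs h y| ≤ 1 := fun y => by
    rw [abs_of_nonneg (disagreeInd_nonneg hs h y)]; exact disagreeInd_le_one hs h y
  set S : (ι → X × Bool) → ℝ := fun z => ∑ i ∈ J, excessLoss hs h (z i) with hS
  set D : (ι → X × Bool) → ℝ := fun z => ∑ i ∈ J, disagreeInd hs h (z i) with hD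
  have ie : ∀ (f : X × Bool → ℝ), Measurable f → (∀ y, |f y| ≤ 1) → ∀ i,
      Integrable (fun z : ι → X × Bool => f (z i)) (Measure.pi P) := fun f hf hb i =>
    (integrable_of_abs_le_one (hf.comp (measurable_pi_apply i)) fun z => hb _).integrable
      one_le_two
  have mean : ∀ (f : X × Bool → ℝ), Measurable f → (∀ y, |f y| ≤ 1) →
      ∫ z, ∑ i ∈ J, f (z i) ∂Measure.pi P = ∑ i ∈ J, ∫ y, f y ∂P i := fun f hf hb => by
    rw [integral_finsetSum _ fun i _ => ie f hf hb i]
    exact Finset.sum_congr rfl fun i _ => integral_comp_eval hf.aestronglyMeasurable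
  have meanS : ∫ z, S z ∂Measure.pi P = F := by rw [hFe]; exact mean _ mf bf
  have meanD : ∫ z, D z ∂Measure.pi P = G := mean _ mg bg
  have hSlp : MemLp S 2 (Measure.pi P) := memLp_finsetSum _ fun i _ =>
    integrable_of_abs_le_one (mf.comp (measurable_pi_apply i)) fun z => bf _
  have hvar : ProbabilityTheory.variance S (Measure.pi P) ≤ G := by
    have e : S = ∑ i, fun z : ι → X × Bool =>
        (fun y => if i ∈ J then excessLoss hs h y else 0) (z i) := by
      funext z
      simp [hS, Finset.sum_apply, Finset.sum_ite_mem]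
    have hX : ∀ i, MemLp (fun y => if i ∈ J then excessLoss hs h y else 0) 2 (P i) := fun i => by
      split_ifs
      · exact integrable_of_abs_le_one mf bf
      · exact MemLp.zero
    rw [e, ProbabilityTheory.variance_sum_pi hX, hG, ← Finset.sum_filter_add_sum_filter_not
      Finset.univ (· ∈ J)]
    have z0 : ∑ i ∈ Finset.univ.filter (· ∉ J), ProbabilityTheory.variance
        (fun y => if i ∈ J then excessLoss hs h y else 0) (P i) = 0 :=
      Finset.sum_eq_zero fun i hi => by
        simp only [(Finset.mem_filter.1 hi).2, if_false]
        exact ProbabilityTheory.variance_zero _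
    rw [z0, add_zero, Finset.filter_univ_mem]
    refine Finset.sum_le_sum fun i hi => ?_
    simp only [hi, if_true]
    refine (ProbabilityTheory.variance_le_expectation_sq mf.aestronglyMeasurable).trans ?_
    refine integral_mono ?_ ?_ fun y => sq_excessLoss_le hs h y
    · exact (integrable_of_abs_le_one mf bf).integrable_sq
    · exact (integrable_of_abs_le_one mg bg).integrable one_le_two
  have hG0 : 0 ≤ G := Finset.sum_nonneg fun i _ => integral_nonneg fun y => disagreeInd_nonneg _ _ _
  have hGF : 16 * G ≤ F ^ 2 := by nlinarith
  -- Chebyshev: the variance is at most `G ≤ F² / 16`.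
  have p1 : Measure.pi P {z | F / 2 ≤ |S z - F|} ≤ ENNReal.ofReal (1 / 4) := by
    have := ProbabilityTheory.meas_ge_le_variance_div_sq hSlp (half_pos hF)
    rw [meanS] at this
    refine this.trans (ENNReal.ofReal_le_ofReal ?_)
    rw [div_le_iff₀ (by positivity)]
    nlinarith
  -- Markov: `G ≤ F² / (48 L)`. Off both bad events `3 L D ≤ F² / 4 ≤ S²`.
  have p2 : Measure.pi P {z | F ^ 2 / (12 * L) ≤ D z} ≤ ENNReal.ofReal (1 / 4) := by
    have hDi : Integrable D (Measure.pi P) := integrable_finsetSum _ fun i _ => ie _ mg bg i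
    have := mul_meas_ge_le_integral_of_nonneg (μ := Measure.pi P) (f := D)
      (Filter.Eventually.of_forall fun z => Finset.sum_nonneg fun i _ => disagreeInd_nonneg _ _ _)
      hDi (F ^ 2 / (12 * L))
    rw [meanD] at this
    rw [← ofReal_measureReal]
    apply ENNReal.ofReal_le_ofReal
    have hpos : 0 < F ^ 2 / (12 * L) := by positivity
    have h4 : G ≤ F ^ 2 / (12 * L) * (1 / 4) := by
      rw [div_mul_eq_mul_div, le_div_iff₀ (by positivity)]; linarith
    exact le_of_mul_le_mul_left (this.trans h4) hpos
  set good := {z : ι → X × Bool | F / 2 ≤ S z ∧ 3 * L * D z ≤ S z ^ 2}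
  have hcover : (Set.univ : Set (ι → X × Bool)) ⊆
      good ∪ ({z | F / 2 ≤ |S z - F|} ∪ {z | F ^ 2 / (12 * L) ≤ D z}) := by
    intro z _
    by_cases c1 : F / 2 ≤ |S z - F|
    · exact Or.inr (Or.inl c1)
    by_cases c2 : F ^ 2 / (12 * L) ≤ D z
    · exact Or.inr (Or.inr c2)
    refine Or.inl ?_
    push Not at c1 c2
    have h1 := (abs_lt.1 c1).1
    have h2 : F / 2 ≤ S z := by linarith
    rw [lt_div_iff₀ (by positivity)] at c2
    exact ⟨h2, by nlinarith⟩
  have h1 := measure_mono (μ := Measure.pi P) hcover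
  rw [measure_univ] at h1
  have h2 : (1 : ℝ≥0∞) ≤ Measure.pi P good + ENNReal.ofReal (1 / 2) := by
    refine h1.trans ((measure_union_le _ _).trans (add_le_add le_rfl
      ((measure_union_le _ _).trans ((add_le_add p1 p2).trans ?_))))
    rw [← ENNReal.ofReal_add (by norm_num) (by norm_num)]
    exact ENNReal.ofReal_le_ofReal (by norm_num)
  have h3 : ENNReal.ofReal (1 / 2) = 1 / 2 := by
    rw [ENNReal.ofReal_div_of_pos (by norm_num)]; simp
  rw [h3] at h2
  have h4 : (1 / 2 : ℝ≥0∞) + 1 / 2 = 1 := ENNReal.add_halves 1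
  exact (ENNReal.add_le_add_iff_right (by simp : (1 / 2 : ℝ≥0∞) ≠ ∞)).1 (h4.trans_le h2)

/-- **Localized uniform deviation bound**: a measurable selection from a VC class that does no worse
than `hs` on the sample has small total excess risk, provided that disagreements are controlled
by excess risks above the level `R`. -/
theorem prob_excess_gt_le {H : Set (Classifier X)} {V : ℕ} (hV : HasVCDim H V)
    (hH : ∀ h ∈ H, Measurable h) (J : Finset ι) {R L : ℝ} (hR : 0 < R) (hL : 1 ≤ L)
    {hs : Classifier X} (hms : Measurable hs) {A : (ι → X × Bool) → Classifier X}
    (hA : ∀ z, A z ∈ H) (hAm : Measurable fun p : (ι → X × Bool) × X => A p.1 p.2)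
    (herm : ∀ z, ∑ i ∈ J, excessLoss hs (A z) (z i) ≤ 0)
    (hnoise : ∀ h ∈ H, R < ∑ i ∈ J, ∫ y, excessLoss hs h y ∂P i →
      48 * L * ∑ i ∈ J, ∫ y, disagreeInd hs h y ∂P i ≤
        (∑ i ∈ J, ∫ y, excessLoss hs h y ∂P i) ^ 2) :
    Measure.pi P {z | R < ∑ i ∈ J, ∫ y, excessLoss hs (A z) y ∂P i} ≤
      ENNReal.ofReal (2 * (growthBound (2 * J.card) V *
        (Real.exp (-(R / 36)) + Real.exp (-(L / 4))))) := by
  classical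
  set μ := Measure.pi P
  set K : ℝ := growthBound (2 * J.card) V * (Real.exp (-(R / 36)) + Real.exp (-(L / 4))) with hK
  have hK0 : 0 ≤ K := by positivity
  set W : Set ((ι → X × Bool) × (ι → X × Bool)) :=
    {q | GhostDeviation J R L hs (A q.1) q} with hW
  have mW : MeasurableSet W := measurableSet_ghostDeviation J R L hms hAm
  -- Averaging over all swaps reduces the claim to counting swaps for a fixed pair of samples. There
  -- the selected classifier is replaced by the existence of some bad one in `H`, so no supremum
  -- over `H` has to be measurable.
  have upper : (μ.prod μ) W ≤ ENNReal.ofReal K := by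
    have hinv : ∀ e : ι → Bool, (μ.prod μ) W =
        ∫⁻ q, (if swapAt e q ∈ W then 1 else 0) ∂(μ.prod μ) := fun e => by
      have hmp := measurePreserving_swapAt P e
      rw [← hmp.measure_preimage mW.nullMeasurableSet,
        ← lintegral_indicator_one (hmp.measurable mW)]
      exact lintegral_congr fun q => by simp [Set.indicator_apply]
    have hsum : (2 ^ Fintype.card ι : ℝ≥0∞) * (μ.prod μ) W =
        ∫⁻ q, ∑ e : ι → Bool, (if swapAt e q ∈ W then 1 else 0) ∂(μ.prod μ) := by
      rw [lintegral_finsetSum]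
      · rw [← Finset.sum_congr rfl fun e _ => hinv e]
        simp
      · intro e _
        exact Measurable.ite ((measurePreserving_swapAt P e).measurable mW) measurable_const
          measurable_const
    have hpt : ∀ q, ∑ e : ι → Bool, (if swapAt e q ∈ W then (1 : ℝ≥0∞) else 0) ≤
        ENNReal.ofReal (2 ^ Fintype.card ι * K) := fun q => by
      rw [Finset.sum_boole]
      have h1 := card_exists_ghostDeviation_le hV J hR (by linarith : 0 < L) hs q
      have h2 : ((Finset.univ.filter fun e : ι → Bool => swapAt e q ∈ W).card : ℝ) ≤
          2 ^ Fintype.card ι * K := by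
        refine le_trans ?_ (h1.trans (le_of_eq (by rw [hK]; ring)))
        exact_mod_cast Finset.card_le_card fun e he => by
          rw [Finset.mem_filter] at he ⊢
          exact ⟨he.1, _, hA _, he.2⟩
      rw [← ENNReal.ofReal_natCast]
      exact ENNReal.ofReal_le_ofReal h2
    have h3 : (2 ^ Fintype.card ι : ℝ≥0∞) * (μ.prod μ) W ≤
        (2 ^ Fintype.card ι : ℝ≥0∞) * ENNReal.ofReal K := by
      rw [hsum]
      refine (lintegral_mono hpt).trans ?_
      rw [lintegral_const, measure_univ, mul_one, ENNReal.ofReal_mul (by positivity),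
        ENNReal.ofReal_pow (by norm_num)]
      simp
    exact (ENNReal.mul_le_mul_iff_right (by positivity) (by simp)).1 h3
  have lower : μ {z | R < ∑ i ∈ J, ∫ y, excessLoss hs (A z) y ∂P i} * (1 / 2) ≤
      (μ.prod μ) W := by
    rw [Measure.prod_apply mW]
    -- Once the sample is fixed the selected classifier is fixed too, and the independent ghost
    -- sample exposes it with probability at least `1 / 2`.
    have hsec : {z | R < ∑ i ∈ J, ∫ y, excessLoss hs (A z) y ∂P i} ⊆
        {z | 1 / 2 ≤ μ (Prod.mk z ⁻¹' W)} := by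
      intro z hz
      have hz' : R < ∑ i ∈ J, ∫ y, excessLoss hs (A z) y ∂P i := hz
      have h1 := half_le_prob_ghost (P := P) hms (hH _ (hA z)) hL (hR.trans hz') rfl
        (hnoise _ (hA z) hz')
      refine h1.trans (measure_mono fun z' hz2 => ?_)
      have hz3 : _ ∧ _ := hz2
      exact ⟨herm z, by linarith [hz3.1], hz3.2⟩
    rw [mul_comm]
    refine le_trans ?_ (mul_meas_ge_le_lintegral (measurable_measure_prodMk_left mW) (1 / 2))
    exact mul_le_mul_right (measure_mono hsec) _
  have h5 := lower.trans upper
  rw [mul_one_div] at h5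
  rw [ENNReal.ofReal_mul (by norm_num), mul_comm]
  have := (ENNReal.div_le_iff (by norm_num) (by norm_num)).1 h5
  simpa using this

end Concentration

/-! ### Growth function against the complexity term. -/

section Growth

/-- With `x = V / n ≤ 1`, multiplying the sum by `x ^ V` bounds it by the binomial expansion of `(1
+ x) ^ n ≤ exp V`. -/
theorem growthBound_le {n V : ℕ} (hV : 0 < V) (hVn : V ≤ n) :
    (growthBound n V : ℝ) ≤ (Real.exp 1 * (n / V)) ^ V := by
  have hV' : (0 : ℝ) < V := by exact_mod_cast hV
  have hn' : (0 : ℝ) < n := by exact_mod_cast hV.trans_le hVn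
  set x : ℝ := V / n with hx
  have hx0 : 0 < x := by positivity
  have hx1 : x ≤ 1 := div_le_one_of_le₀ (by exact_mod_cast hVn) hn'.le
  have h1 : (growthBound n V : ℝ) * x ^ V ≤ (1 + x) ^ n := by
    rw [growthBound, Nat.cast_sum, Finset.sum_mul, add_comm, add_pow]
    have hsub : Finset.Iic V ⊆ Finset.range (n + 1) := fun k hk =>
      Finset.mem_range.2 (Nat.lt_succ_of_le ((Finset.mem_Iic.1 hk).trans hVn))
    refine le_trans (Finset.sum_le_sum fun k hk => ?_)
      (Finset.sum_le_sum_of_subset_of_nonneg hsub fun k _ _ => by positivity)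
    rw [one_pow, mul_one, mul_comm]
    exact mul_le_mul_of_nonneg_right
      (pow_le_pow_of_le_one hx0.le hx1 (Finset.mem_Iic.1 hk)) (by positivity)
  have h2 : (1 + x) ^ n ≤ Real.exp 1 ^ V := by
    calc (1 + x) ^ n ≤ Real.exp x ^ n :=
          pow_le_pow_left₀ (by positivity) (by linarith [Real.add_one_le_exp x]) n
      _ = Real.exp 1 ^ V := by
          rw [← Real.exp_nat_mul, ← Real.exp_nat_mul, hx]
          congr 1
          field_simp
  have h3 := h1.trans h2
  rw [← le_div_iff₀ (by positivity)] at h3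
  refine h3.trans (le_of_eq ?_)
  rw [hx, ← div_pow]
  congr 1
  field_simp

/-- The complexity term `V log (m / V) + log (1 / δ)`. -/
noncomputable def complexity (V : ℕ) (m δ : ℝ) : ℝ := V * posLog (m / V) + posLog (1 / δ)

theorem one_le_complexity (V : ℕ) (m δ : ℝ) : 1 ≤ complexity V m δ := by
  have h1 := posLog_pos (m / V)
  have : 0 ≤ V * posLog (m / V) := by positivity
  unfold complexity
  linarith [one_le_posLog (1 / δ)]

theorem log_two_le_one : Real.log 2 ≤ 1 := by
  have := Real.log_two_lt_d9
  linarith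

/-- Both the union bound and the confidence level are paid for by `exp (-5Λ)`, with `Λ` the
complexity term. The factor `4` accounts for the two tails and the `1 / 2` lost to the ghost sample.
-/
theorem four_mul_growthBound_le {m V : ℕ} (hV : 0 < V) (hVm : V ≤ m) {δ : ℝ} (hδ : 0 < δ) :
    4 * (growthBound (2 * m) V : ℝ) ≤ δ * Real.exp (5 * complexity V m δ) := by
  have hV' : (0 : ℝ) < V := by exact_mod_cast hV
  have hV1 : (1 : ℝ) ≤ V := by exact_mod_cast hV
  have hm' : (0 : ℝ) < m := by exact_mod_cast hV.trans_le hVm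
  have h1 := growthBound_le hV (by omega : V ≤ 2 * m)
  have e1 : (Real.exp 1 * ((2 * m : ℕ) / V)) ^ V =
      Real.exp (V * (1 + Real.log 2 + Real.log (m / V))) := by
    rw [Real.exp_nat_mul, Real.exp_add, Real.exp_add, Real.exp_log (by norm_num),
      Real.exp_log (by positivity)]
    push_cast
    congr 1
    ring
  have e2 : (4 : ℝ) = Real.exp (2 * Real.log 2) := by
    rw [mul_comm, Real.exp_mul, Real.exp_log (by norm_num)]; norm_num
  have e3 : δ = Real.exp (-Real.log (1 / δ)) := by
    rw [one_div, Real.log_inv, neg_neg, Real.exp_log hδ]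
  have h2 : Real.log (m / V) ≤ posLog (m / V) := le_max_left _ _
  have h3 : Real.log (1 / δ) ≤ posLog (1 / δ) := le_max_left _ _
  have h4 := one_le_posLog ((m : ℝ) / V)
  have h5 := one_le_posLog (1 / δ)
  have h6 := log_two_le_one
  rw [e1] at h1
  refine (mul_le_mul_of_nonneg_left h1 (by norm_num)).trans ?_
  conv_lhs => rw [e2]
  nth_rewrite 1 [e3]
  rw [← Real.exp_add, ← Real.exp_add]
  apply Real.exp_le_exp.2
  unfold complexity
  nlinarith [mul_le_mul_of_nonneg_left h2 hV'.le, mul_le_mul_of_nonneg_left h4 hV'.le,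
    mul_le_mul_of_nonneg_left h6 hV'.le]

end Growth

/-! ### Expected losses as risks. -/

section RiskIdentities

variable {X : Type u} [MeasurableSpace X] {H : Set (Classifier X)} {P : Measure (X × Bool)}
  {hs h : Classifier X}

theorem integral_ite_eq_real {Ω : Type*} [MeasurableSpace Ω] (μ : Measure Ω) (p : Ω → Prop)
    [DecidablePred p] (hp : MeasurableSet {ω | p ω}) :
    ∫ ω, (if p ω then (1 : ℝ) else 0) ∂μ = μ.real {ω | p ω} := by
  rw [← integral_indicator_one hp]
  exact integral_congr_ae (Filter.Eventually.of_forall fun ω => by simp [Set.indicator_apply])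

theorem integral_excessLoss [IsProbabilityMeasure P] (hms : Measurable hs) (hm : Measurable h) :
    ∫ y, excessLoss hs h y ∂P = risk P h - risk P hs := by
  have hi : ∀ g : Classifier X, Measurable g →
      Integrable (fun y : X × Bool => if g y.1 ≠ y.2 then (1 : ℝ) else 0) P := fun g hg =>
    (integrable_of_abs_le_one (measurable_ite_eq (hg.comp measurable_fst) measurable_snd)
      fun y => by split_ifs <;> norm_num).integrable one_le_two
  unfold excessLoss
  rw [integral_sub (hi h hm) (hi hs hms), integral_ite_eq_real _ _ (measurableSet_error hm),
    integral_ite_eq_real _ _ (measurableSet_error hms)]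
  rfl

theorem integral_disagreeInd (hms : Measurable hs) (hm : Measurable h) :
    ∫ y, disagreeInd hs h y ∂P = disagreement P h hs :=
  integral_ite_eq_real _ _ (measurableSet_disagreement hm hms)

theorem excessRisk_nonneg (hbest : IsBest H P hs) (hh : h ∈ H) : 0 ≤ excessRisk H P h := by
  rw [excessRisk_eq_of_isBest hbest]
  exact sub_nonneg.2 (hbest.2 h hh)

theorem excessRisk_le_one [IsProbabilityMeasure P] (hbest : IsBest H P hs) : excessRisk H P h ≤ 1 := by
  rw [excessRisk_eq_of_isBest hbest]
  have h1 : risk P h ≤ 1 := measureReal_le_one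
  have h2 : 0 ≤ risk P hs := measureReal_nonneg
  linarith

end RiskIdentities

/-! ### Pooling the Bernstein condition and transferring to the target. -/

section Pooling

variable {X : Type u} [MeasurableSpace X] {H : Set (Classifier X)} {N : ℕ}

namespace Params

variable {M : Params N} {P : Fin (N + 1) → Measure (X × Bool)} {σ : Equiv.Perm (Fin (N + 1))}

theorem exponent_pos (M : Params N) (t : Fin (N + 1)) : 0 < M.exponent t := by
  refine Fin.lastCases ?_ (fun i => ?_) t
  · simp [Params.exponent]
  · simpa [Params.exponent] using M.ρ_pos i

theorem Mem.transferExponent (hP : M.Mem H P) (t : Fin (N + 1)) :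
    TransferExponent H (P t) (P (Fin.last N)) M.Cρ (M.exponent t) := by
  refine Fin.lastCases ?_ (fun i => ?_) t
  · intro h hh
    have := hP.prob (Fin.last N)
    obtain ⟨hs, hbest⟩ := hP.common_best
    have h0 := excessRisk_nonneg (hbest (Fin.last N)) hh
    have h2 := M.two_le_Cρ
    simp only [Params.exponent, Fin.snoc_last, inv_one, ENNReal.toReal_one, Real.rpow_one]
    nlinarith
  · have := hP.transfer i
    simpa [Params.exponent] using this

/-- The excess risk of `h` summed over the pooled samples. -/
noncomputable def pooledExcess (M : Params N) (H : Set (Classifier X))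
    (P : Fin (N + 1) → Measure (X × Bool)) (σ : Equiv.Perm (Fin (N + 1))) (t : Fin (N + 1))
    (h : Classifier X) : ℝ :=
  ∑ s ∈ Finset.Iic t, (M.n (σ s) : ℝ) * excessRisk H (P (σ s)) h

/-- Jensen's inequality for the concave function `x ^ β`, with the sample proportions as weights. -/
theorem Mem.pooled_disagreement_le (hP : M.Mem H P) {t : Fin (N + 1)}
    (ht : M.prefixSize σ t ≠ 0) {hs : Classifier X} (hbest : ∀ s, IsBest H (P s) hs)
    {h : Classifier X} (hh : h ∈ H) :
    ∑ s ∈ Finset.Iic t, (M.n (σ s) : ℝ) * disagreement (P (σ s)) h hs ≤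
      M.Cβ * M.prefixSize σ t * (M.pooledExcess H P σ t h / M.prefixSize σ t) ^ M.β := by
  have hm : (0 : ℝ) < M.prefixSize σ t := by exact_mod_cast Nat.pos_of_ne_zero ht
  have hC : 0 ≤ M.Cβ := by linarith [M.two_le_Cβ]
  have := hP.prob
  have hE : ∀ s, 0 ≤ excessRisk H (P s) h := fun s => excessRisk_nonneg (hbest s) hh
  have hw1 : ∑ s ∈ Finset.Iic t, (M.n (σ s) : ℝ) / M.prefixSize σ t = 1 := by
    rw [← Finset.sum_div, ← Nat.cast_sum, ← prefixSize, div_self hm.ne']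
  have h1 := (Real.concaveOn_rpow M.β_nonneg M.β_le_one).le_map_sum (t := Finset.Iic t)
    (w := fun s => (M.n (σ s) : ℝ) / M.prefixSize σ t)
    (p := fun s => excessRisk H (P (σ s)) h) (fun s _ => by positivity) hw1
    (fun s _ => hE (σ s))
  simp only [smul_eq_mul] at h1
  have e1 : ∑ s ∈ Finset.Iic t, (M.n (σ s) : ℝ) / M.prefixSize σ t * excessRisk H (P (σ s)) h =
      M.pooledExcess H P σ t h / M.prefixSize σ t := by
    rw [pooledExcess, Finset.sum_div]
    exact Finset.sum_congr rfl fun s _ => by ring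
  rw [e1] at h1
  calc ∑ s ∈ Finset.Iic t, (M.n (σ s) : ℝ) * disagreement (P (σ s)) h hs
      ≤ ∑ s ∈ Finset.Iic t, (M.n (σ s) : ℝ) * (M.Cβ * excessRisk H (P (σ s)) h ^ M.β) :=
        Finset.sum_le_sum fun s _ => mul_le_mul_of_nonneg_left
          (hP.bernstein (σ s) hs (hbest _) h hh) (by positivity)
    _ = M.Cβ * M.prefixSize σ t * ∑ s ∈ Finset.Iic t,
          (M.n (σ s) : ℝ) / M.prefixSize σ t * excessRisk H (P (σ s)) h ^ M.β := by
        rw [Finset.mul_sum]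
        exact Finset.sum_congr rfl fun s _ => by field_simp
    _ ≤ _ := mul_le_mul_of_nonneg_left h1 (by positivity)

theorem avgExponent_toReal {t : Fin (N + 1)} (htop : M.avgExponent σ t ≠ ∞) :
    (∀ s ∈ Finset.Iic t, M.n (σ s) ≠ 0 → M.exponent (σ s) ≠ ∞) ∧
    (M.avgExponent σ t).toReal = ∑ s ∈ Finset.Iic t,
      (M.n (σ s) : ℝ) / M.prefixSize σ t * (M.exponent (σ s)).toReal := by
  have h1 : ∑ s ∈ Finset.Iic t, (M.n (σ s) : ℝ≥0∞) * M.exponent (σ s) ≠ ∞ := by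
    intro h
    rw [avgExponent, h, ENNReal.top_div_of_ne_top (ENNReal.natCast_ne_top _)] at htop
    exact htop rfl
  have h2 := ENNReal.sum_ne_top.1 h1
  refine ⟨fun s hs hn he => h2 s hs ?_, ?_⟩
  · rw [he, ENNReal.mul_top (by exact_mod_cast hn)]
  · rw [avgExponent, ENNReal.toReal_div, ENNReal.toReal_sum h2, Finset.sum_div]
    refine Finset.sum_congr rfl fun s _ => ?_
    rw [ENNReal.toReal_mul, ENNReal.toReal_natCast, ENNReal.toReal_natCast]
    ring

/-- Transfer of a bound on the pooled excess risk to the target. -/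
theorem Mem.excessRisk_target_le (hP : M.Mem H P) {t : Fin (N + 1)} (ht : M.prefixSize σ t ≠ 0)
    {h : Classifier X} (hh : h ∈ H) {b : ℝ} (hb : 0 ≤ b)
    (hF : M.pooledExcess H P σ t h ≤ M.prefixSize σ t * b ^ (1 / (2 - M.β))) :
    excessRisk H (P (Fin.last N)) h ≤ M.Cρ * b ^ M.ratePower σ t := by
  have hm : (0 : ℝ) < M.prefixSize σ t := by exact_mod_cast Nat.pos_of_ne_zero ht
  have hC : 2 ≤ M.Cρ := M.two_le_Cρ
  have := hP.prob
  obtain ⟨hs, hbest⟩ := hP.common_best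
  have hE : ∀ s, 0 ≤ excessRisk H (P s) h := fun s => excessRisk_nonneg (hbest s) hh
  by_cases htop : M.avgExponent σ t = ∞
  · have h1 : M.ratePower σ t = 0 := by simp [ratePower, htop]
    rw [h1, Real.rpow_zero]
    linarith [excessRisk_le_one (h := h) (hbest (Fin.last N))]
  obtain ⟨hfin, havg⟩ := avgExponent_toReal htop
  set r : ℝ := (M.avgExponent σ t).toReal with hr
  set y : ℝ := excessRisk H (P (Fin.last N)) h / M.Cρ with hy
  have hy0 : 0 ≤ y := div_nonneg (hE _) (by linarith)
  have hy1 : excessRisk H (P (Fin.last N)) h = M.Cρ * y := by rw [hy]; field_simp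
  -- The product formula for real powers used below needs a positive base.
  rcases hy0.eq_or_lt with hy00 | hypos
  · rw [hy1, ← hy00, mul_zero]
    exact mul_nonneg (by linarith) (Real.rpow_nonneg hb _)
  have hrpos : 0 < r := by
    rw [havg]
    obtain ⟨s, hs, hn⟩ := Finset.exists_ne_zero_of_sum_ne_zero ht
    refine Finset.sum_pos' (fun s _ => by positivity) ⟨s, hs, ?_⟩
    have h1 : 0 < (M.exponent (σ s)).toReal :=
      ENNReal.toReal_pos (M.exponent_pos _).ne' (hfin s hs hn)
    have h2 : (0 : ℝ) < M.n (σ s) := by exact_mod_cast Nat.pos_of_ne_zero hn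
    positivity
  have hw1 : ∑ s ∈ Finset.Iic t, (M.n (σ s) : ℝ) / M.prefixSize σ t = 1 := by
    rw [← Finset.sum_div, ← Nat.cast_sum, ← prefixSize, div_self hm.ne']
  have hstep : ∀ s ∈ Finset.Iic t, (M.n (σ s) : ℝ) / M.prefixSize σ t *
      y ^ (M.exponent (σ s)).toReal ≤
      (M.n (σ s) : ℝ) / M.prefixSize σ t * excessRisk H (P (σ s)) h := by
    intro s hs
    by_cases hn : M.n (σ s) = 0
    · simp [hn]
    refine mul_le_mul_of_nonneg_left ?_ (by positivity)
    have h1 : 0 < (M.exponent (σ s)).toReal :=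
      ENNReal.toReal_pos (M.exponent_pos _).ne' (hfin s hs hn)
    rw [← Real.le_rpow_inv_iff_of_pos hy0 (hE _) h1]
    have h2 := hP.transferExponent (σ s) h hh
    rw [hy1, ENNReal.toReal_inv] at h2
    exact le_of_mul_le_mul_left h2 (by linarith)
  -- The weighted geometric mean of the `y ^ ρ_s` is `y ^ ρ̄`: this is where the average exponent
  -- appears.
  have hamgm := Real.geom_mean_le_arith_mean_weighted (Finset.Iic t)
    (fun s => (M.n (σ s) : ℝ) / M.prefixSize σ t) (fun s => y ^ (M.exponent (σ s)).toReal)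
    (fun s _ => by positivity) hw1 (fun s _ => Real.rpow_nonneg hy0 _)
  have e1 : ∏ s ∈ Finset.Iic t, (y ^ (M.exponent (σ s)).toReal) ^
      ((M.n (σ s) : ℝ) / M.prefixSize σ t) = y ^ r := by
    rw [havg, Real.rpow_sum_of_pos hypos]
    refine Finset.prod_congr rfl fun s _ => ?_
    rw [← Real.rpow_mul hy0, mul_comm]
  rw [e1] at hamgm
  have h3 : y ^ r ≤ b ^ (1 / (2 - M.β)) := by
    refine hamgm.trans ((Finset.sum_le_sum hstep).trans ?_)
    have e2 : ∑ s ∈ Finset.Iic t, (M.n (σ s) : ℝ) / M.prefixSize σ t *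
        excessRisk H (P (σ s)) h = M.pooledExcess H P σ t h / M.prefixSize σ t := by
      rw [pooledExcess, Finset.sum_div]
      exact Finset.sum_congr rfl fun s _ => by ring
    rw [e2, div_le_iff₀ hm]
    linarith
  have h4 : y ≤ (b ^ (1 / (2 - M.β))) ^ r⁻¹ :=
    (Real.le_rpow_inv_iff_of_pos hy0 (Real.rpow_nonneg hb _) hrpos).2 h3
  rw [hy1, ratePower, ENNReal.toReal_inv, Real.rpow_mul hb]
  exact mul_le_mul_of_nonneg_left h4 (by linarith)

end Params

end Pooling

/-! ### The high-probability bound for empirical risk minimization on a prefix. -/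

section UpperBound

variable {X : Type u} [MeasurableSpace X] {H : Set (Classifier X)} {N : ℕ}

/-- Flattens the multisample into one family of independent observations, as the deviation bound
requires. -/
theorem sampleLaw_eq_map (n : Fin (N + 1) → ℕ) (P : Fin (N + 1) → Measure (X × Bool))
    [∀ t, IsProbabilityMeasure (P t)] :
    sampleLaw n P = (Measure.pi fun p : (t : Fin (N + 1)) × Fin (n t) => P p.1).map
      (MeasurableEquiv.piCurry fun _ _ => X × Bool) := by
  have := Measure.infinitePi_map_piCurry (X := fun (t : Fin (N + 1)) (_ : Fin (n t)) => X × Bool)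
    (fun t _ => P t)
  simp only [Measure.infinitePi_eq_pi] at this
  exact this.symm

theorem sum_prefixSet_sigma {M : Params N} (σ : Equiv.Perm (Fin (N + 1))) (t : Fin (N + 1))
    (f : ((s : Fin (N + 1)) × Fin (M.n s)) → ℝ) :
    ∑ p ∈ (Params.prefixSet σ t).sigma (fun _ => Finset.univ), f p =
      ∑ s ∈ Finset.Iic t, ∑ i : Fin (M.n (σ s)), f ⟨σ s, i⟩ := by
  rw [Finset.sum_sigma, Params.prefixSet, Finset.sum_map]
  rfl

theorem card_prefixSet_sigma {M : Params N} (σ : Equiv.Perm (Fin (N + 1))) (t : Fin (N + 1)) :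
    ((Params.prefixSet σ t).sigma (fun s => (Finset.univ : Finset (Fin (M.n s))))).card =
      M.prefixSize σ t := by
  simp [Params.prefixSet, Params.prefixSize]

theorem sum_prefixSet_eq_prefixSize {M : Params N} (σ : Equiv.Perm (Fin (N + 1)))
    (t : Fin (N + 1)) : ∑ s ∈ Params.prefixSet σ t, M.n s = M.prefixSize σ t := by
  simp [Params.prefixSet, Params.prefixSize]

/-- The empirical risk minimizer on a prefix of the tasks attains the rate of that prefix. -/
theorem prob_excessRisk_gt_le (hH : ∀ h ∈ H, Measurable h) {V : ℕ} (hV : HasVCDim H V)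
    (hV0 : 0 < V) (M : Params N) (σ : Equiv.Perm (Fin (N + 1))) {t : Fin (N + 1)}
    (ht : M.prefixSize σ t ≠ 0) {δ : ℝ} (hδ : 0 < δ) {A : MultiSample X M.n → Classifier X}
    (hAm : MeasurableLearner A) (hA : IsERM H (Params.prefixSet σ t) A)
    {P : Fin (N + 1) → Measure (X × Bool)} (hP : M.Mem H P) :
    sampleLaw M.n P {z | M.Cρ * (960 * M.Cβ * (complexity V (M.prefixSize σ t) δ /
      M.prefixSize σ t)) ^ M.ratePower σ t < excessRisk H (P (Fin.last N)) (A z)} ≤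
      ENNReal.ofReal δ := by
  have := hP.prob
  obtain ⟨hs, hbest⟩ := hP.common_best
  have hms := hH hs (hbest 0).1
  have hCβ := M.two_le_Cβ
  have hCρ := M.two_le_Cρ
  have hm : (0 : ℝ) < M.prefixSize σ t := by exact_mod_cast Nat.pos_of_ne_zero ht
  have hΛ := one_le_complexity V (M.prefixSize σ t) δ
  set m : ℕ := M.prefixSize σ t with hm_def
  set Λ : ℝ := complexity V m δ with hΛ_def
  set b : ℝ := 960 * M.Cβ * (Λ / m) with hb_def
  have hb0 : 0 < b := by positivity
  have hbm : m * b = 960 * M.Cβ * Λ := by rw [hb_def]; field_simp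
  -- If `b ≥ 1` the claimed bound exceeds `1` and the event is empty. So `b < 1`, and this forces `V
  -- ≤ m` because `Λ ≥ V`.
  rcases le_or_gt 1 b with hb1 | hb1
  · have hempty : {z | M.Cρ * b ^ M.ratePower σ t <
        excessRisk H (P (Fin.last N)) (A z)} = ∅ := by
      refine Set.eq_empty_iff_forall_notMem.2 fun z hz => ?_
      have hz' : M.Cρ * b ^ M.ratePower σ t < excessRisk H (P (Fin.last N)) (A z) := hz
      have h1 : 1 ≤ b ^ M.ratePower σ t := Real.one_le_rpow hb1 (M.ratePower_nonneg t)
      have h2 := excessRisk_le_one (h := A z) (hbest (Fin.last N))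
      nlinarith
    rw [hempty, measure_empty]
    exact zero_le
  have hVm : V ≤ m := by
    by_contra hcon
    push Not at hcon
    have h1 : (m : ℝ) ≤ V := by exact_mod_cast hcon.le
    have h2 : (V : ℝ) ≤ Λ := by
      have := one_le_posLog ((m : ℝ) / V)
      have h3 := posLog_pos (1 / δ)
      have h4 : (0 : ℝ) < V := by exact_mod_cast hV0
      rw [hΛ_def, complexity]
      nlinarith
    nlinarith
  have hβ : 0 < 2 - M.β := by linarith [M.β_le_one]
  set r : ℝ := b ^ (1 / (2 - M.β)) with hr_def
  have hr0 : 0 < r := Real.rpow_pos_of_pos hb0 _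
  have hbr : b ≤ r := by
    calc b = b ^ (1 : ℝ) := (Real.rpow_one b).symm
      _ ≤ r := Real.rpow_le_rpow_of_exponent_ge hb0 hb1.le
          (div_le_one_of_le₀ (by linarith [M.β_le_one]) hβ.le)
  set J : Finset ((s : Fin (N + 1)) × Fin (M.n s)) :=
    (Params.prefixSet σ t).sigma fun _ => Finset.univ with hJ
  have hJF : ∀ h ∈ H, ∑ p ∈ J, ∫ y, excessLoss hs h y ∂P p.1 = M.pooledExcess H P σ t h := by
    intro h hh
    rw [hJ, sum_prefixSet_sigma, Params.pooledExcess]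
    refine Finset.sum_congr rfl fun s _ => ?_
    simp only [integral_excessLoss hms (hH h hh), ← excessRisk_eq_of_isBest (hbest (σ s))]
    simp
  have hJG : ∀ h ∈ H, ∑ p ∈ J, ∫ y, disagreeInd hs h y ∂P p.1 =
      ∑ s ∈ Finset.Iic t, (M.n (σ s) : ℝ) * disagreement (P (σ s)) h hs := by
    intro h hh
    rw [hJ, sum_prefixSet_sigma]
    refine Finset.sum_congr rfl fun s _ => ?_
    simp only [integral_disagreeInd hms (hH h hh)]
    simp
  set curry := MeasurableEquiv.piCurry fun (s : Fin (N + 1)) (_ : Fin (M.n s)) => X × Bool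
  rw [sampleLaw_eq_map, MeasurableEquiv.map_apply]
  -- `L = 20Λ` gives `L / 4 = 5Λ`, and `m r ≥ m b = 960 Cβ Λ` gives `R / 36 ≥ 5Λ`. The constant is
  -- `960 = 48 · 20`, so that the noise condition reads `b x ^ β ≤ x ^ 2` for the average excess `x
  -- > r`, where `r ^ (2 - β) = b`.
  have hmain := prob_excess_gt_le (P := fun p : (s : Fin (N + 1)) × Fin (M.n s) => P p.1) hV hH J
    (R := m * r) (L := 20 * Λ) (by positivity) (by linarith) hms (A := fun z => A (curry z))
    (fun z => hA.1 _) (hAm.comp (Measurable.prodMap curry.measurable measurable_id))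
    (fun z => by
      have h1 := hA.2 (curry z) hs (hbest 0).1
      unfold empRisk at h1
      rw [sum_prefixSet_eq_prefixSize, div_le_div_iff_of_pos_right hm] at h1
      rw [hJ, Finset.sum_sigma]
      simp only [excessLoss, Finset.sum_sub_distrib]
      exact sub_nonpos.2 h1)
    (fun h hh hlt => by
      rw [hJF h hh] at hlt ⊢
      rw [hJG h hh]
      have h1 := hP.pooled_disagreement_le ht hbest hh
      set F := M.pooledExcess H P σ t h
      rw [← hm_def] at h1
      set x : ℝ := F / m with hx_def
      have hxF : F = m * x := by rw [hx_def]; field_simp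
      have hrx : r < x := by rw [hx_def, lt_div_iff₀ hm]; linarith
      have hx0 : 0 < x := hr0.trans hrx
      have h2 : b ≤ x ^ (2 - M.β) := by
        have e : r ^ (2 - M.β) = b := by
          rw [hr_def, ← Real.rpow_mul hb0.le, one_div_mul_cancel hβ.ne', Real.rpow_one]
        rw [← e]
        exact Real.rpow_le_rpow hr0.le hrx.le hβ.le
      have h3 : x ^ (2 - M.β) * x ^ M.β = x ^ 2 := by
        rw [← Real.rpow_add hx0, sub_add_cancel]
        exact Real.rpow_ofNat x 2
      have h4 : 0 < x ^ M.β := Real.rpow_pos_of_pos hx0 _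
      calc 48 * (20 * Λ) * ∑ s ∈ Finset.Iic t, (M.n (σ s) : ℝ) * disagreement (P (σ s)) h hs
          ≤ 48 * (20 * Λ) * (M.Cβ * m * x ^ M.β) := by gcongr
        _ = m ^ 2 * (b * x ^ M.β) := by
            linear_combination (-(m : ℝ) * x ^ M.β) * hbm
        _ ≤ m ^ 2 * (x ^ (2 - M.β) * x ^ M.β) := by gcongr
        _ = F ^ 2 := by rw [h3, hxF]; ring)
  refine (measure_mono ?_).trans (hmain.trans (ENNReal.ofReal_le_ofReal ?_))
  · intro z hz
    have hz' : M.Cρ * b ^ M.ratePower σ t < excessRisk H (P (Fin.last N)) (A (curry z)) := hz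
    change (m : ℝ) * r < ∑ p ∈ J, ∫ y, excessLoss hs (A (curry z)) y ∂P p.1
    rw [hJF _ (hA.1 _)]
    by_contra hcon
    push Not at hcon
    exact absurd (hP.excessRisk_target_le ht (hA.1 _) hb0.le hcon) (not_le.2 hz')
  · rw [hJ, card_prefixSet_sigma, ← hm_def]
    have h1 := four_mul_growthBound_le hV0 hVm hδ
    rw [← hΛ_def] at h1
    have h2 : Real.exp (-(m * r / 36)) ≤ Real.exp (-(5 * Λ)) := by
      apply Real.exp_le_exp.2
      have : (m : ℝ) * b ≤ m * r := by gcongr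
      nlinarith
    have h3 : Real.exp (-(20 * Λ / 4)) = Real.exp (-(5 * Λ)) := by congr 1; ring
    have h4 : Real.exp (5 * Λ) * Real.exp (-(5 * Λ)) = 1 := by
      rw [← Real.exp_add]; simp
    rw [h3]
    have h5 : (0 : ℝ) ≤ growthBound (2 * m) V := by positivity
    calc 2 * ((growthBound (2 * m) V : ℝ) *
          (Real.exp (-(m * r / 36)) + Real.exp (-(5 * Λ))))
        ≤ 2 * ((growthBound (2 * m) V : ℝ) *
          (Real.exp (-(5 * Λ)) + Real.exp (-(5 * Λ)))) := by gcongr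
      _ = 4 * (growthBound (2 * m) V : ℝ) * Real.exp (-(5 * Λ)) := by ring
      _ ≤ δ * Real.exp (5 * Λ) * Real.exp (-(5 * Λ)) := by gcongr
      _ = δ := by rw [mul_assoc, h4, mul_one]

theorem le_prob_excessRisk_le (hH : ∀ h ∈ H, Measurable h) {V : ℕ} (hV : HasVCDim H V)
    (hV0 : 0 < V) (M : Params N) (σ : Equiv.Perm (Fin (N + 1))) {δ : ℝ} (hδ : 0 < δ)
    {t : Fin (N + 1)} (hmin : ∀ s, M.upperTerm 960 V δ σ t ≤ M.upperTerm 960 V δ σ s)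
    {A : MultiSample X M.n → Classifier X} (hAm : MeasurableLearner A)
    (hA : IsERM H (Params.prefixSet σ t) A) {P : Fin (N + 1) → Measure (X × Bool)}
    (hP : M.Mem H P) :
    ENNReal.ofReal (1 - δ) ≤ sampleLaw M.n P
      {z | ENNReal.ofReal (excessRisk H (P (Fin.last N)) (A z)) ≤
        ⨅ s, M.upperTerm 960 V δ σ s} := by
  have := hP.prob
  have hinf : ⨅ s, M.upperTerm 960 V δ σ s = M.upperTerm 960 V δ σ t :=
    le_antisymm (iInf_le _ t) (le_iInf hmin)
  have : IsProbabilityMeasure (sampleLaw M.n P) := by unfold sampleLaw; infer_instance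
  rw [hinf, Params.upperTerm, orTop]
  split_ifs with ht
  · have : {z : MultiSample X M.n |
        ENNReal.ofReal (excessRisk H (P (Fin.last N)) (A z)) ≤ ∞} = Set.univ :=
      Set.eq_univ_iff_forall.2 fun z => le_top (α := ℝ≥0∞)
    rw [this, measure_univ, ← ENNReal.ofReal_one]
    exact ENNReal.ofReal_le_ofReal (by linarith)
  have hbad := prob_excessRisk_gt_le hH hV hV0 M σ ht hδ hAm hA hP
  set B : ℝ := M.Cρ * (960 * M.Cβ * (complexity V (M.prefixSize σ t) δ /
    M.prefixSize σ t)) ^ M.ratePower σ t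
  have hcover : (Set.univ : Set (MultiSample X M.n)) ⊆
      {z | ENNReal.ofReal (excessRisk H (P (Fin.last N)) (A z)) ≤ ENNReal.ofReal B} ∪
      {z | B < excessRisk H (P (Fin.last N)) (A z)} := fun z _ => by
    rcases le_or_gt (excessRisk H (P (Fin.last N)) (A z)) B with h | h
    · exact Or.inl (ENNReal.ofReal_le_ofReal h)
    · exact Or.inr h
  have h1 := (measure_mono (μ := sampleLaw M.n P) hcover).trans (measure_union_le _ _)
  rw [measure_univ] at h1
  rw [ENNReal.ofReal_sub _ hδ.le, ENNReal.ofReal_one]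
  exact tsub_le_iff_right.2 (h1.trans (add_le_add le_rfl hbad))

end UpperBound

/-! ### The upper bound in expectation. -/

section MinimaxUpperBound

variable {X : Type u} [MeasurableSpace X] {H : Set (Classifier X)} {N : ℕ}

theorem exists_measurable_isERM (hE : AdmitsMeasurableERM H) (n : Fin (N + 1) → ℕ)
    (I : Finset (Fin (N + 1))) :
    ∃ A : MultiSample X n → Classifier X, MeasurableLearner A ∧ IsERM H I A := by
  set J : Finset ((s : Fin (N + 1)) × Fin (n s)) := I.sigma fun _ => Finset.univ with hJ
  obtain ⟨A₀, hmem, hmeas, hopt⟩ := hE J.card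
  let e := J.equivFin
  let f : MultiSample X n → Fin J.card → X × Bool := fun z k => z (e.symm k).1.1 (e.symm k).1.2
  have hf : Measurable f := measurable_pi_iff.2 fun k =>
    (measurable_pi_apply _).comp (measurable_pi_apply _)
  have hsum : ∀ (z : MultiSample X n) (φ : X × Bool → ℝ),
      ∑ k, φ (f z k) = ∑ s ∈ I, ∑ i, φ (z s i) := fun z φ => by
    have h1 : ∑ k, φ (f z k) = ∑ p : J, φ (z p.1.1 p.1.2) :=
      Equiv.sum_comp e.symm fun p : J => φ (z p.1.1 p.1.2)
    rw [h1, Finset.sum_coe_sort J fun p => φ (z p.1 p.2), hJ, Finset.sum_sigma]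
  refine ⟨fun z => A₀ (f z), hmeas.comp (Measurable.prodMap hf measurable_id),
    fun z => hmem _, fun z h hh => ?_⟩
  have h1 := hopt (f z) h hh
  rw [hsum z fun y => if A₀ (f z) y.1 ≠ y.2 then (1 : ℝ) else 0,
    hsum z fun y => if h y.1 ≠ y.2 then (1 : ℝ) else 0] at h1
  exact div_le_div_of_nonneg_right h1 (Nat.cast_nonneg _)

/-- Bounds the integrand by `B` off the bad event and by `1` on it; a measurable hull replaces the
event, whose measurability is not needed. -/
theorem lintegral_le_add_of_le_one {Ω : Type*} [MeasurableSpace Ω] {μ : Measure Ω}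
    [IsProbabilityMeasure μ] {f : Ω → ℝ} {B δ : ℝ} (h1 : ∀ ω, f ω ≤ 1)
    (hbad : μ {ω | B < f ω} ≤ ENNReal.ofReal δ) :
    ∫⁻ ω, ENNReal.ofReal (f ω) ∂μ ≤ ENNReal.ofReal B + ENNReal.ofReal δ := by
  set T := toMeasurable μ {ω | B < f ω}
  have hpt : ∀ ω, ENNReal.ofReal (f ω) ≤ ENNReal.ofReal B + T.indicator 1 ω := fun ω => by
    rcases le_or_gt (f ω) B with h | h
    · exact (ENNReal.ofReal_le_ofReal h).trans le_self_add
    · have : ω ∈ T := subset_toMeasurable _ _ h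
      rw [Set.indicator_of_mem this, Pi.one_apply]
      exact (ENNReal.ofReal_le_one.2 (h1 ω)).trans le_add_self
  refine (lintegral_mono hpt).trans ?_
  rw [lintegral_add_left measurable_const, lintegral_const, measure_univ, mul_one,
    lintegral_indicator_one (measurableSet_toMeasurable _ _), measure_toMeasurable]
  exact add_le_add le_rfl hbad

theorem posLog_mono {x y : ℝ} (hx : 0 < x) (hxy : x ≤ y) : posLog x ≤ posLog y :=
  max_le_max (Real.log_le_log hx hxy) le_rfl

/-- At `δ = 1 / (2m)` the complexity is at most `3 V log m`, and `e ≤ 1` lets the constants leave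
the power. In `2881 = 3 · 960 + 1` the last unit pays for `δ ≤ m ^ (-e)`. -/
theorem rate_at_inv_two_mul_le {V : ℕ} (hV : 0 < V) {m : ℕ} (hm0 : m ≠ 0) {Cρ Cβ e : ℝ}
    (hCρ : 2 ≤ Cρ) (hCβ : 2 ≤ Cβ) (he0 : 0 ≤ e) (he1 : e ≤ 1) :
    Cρ * (960 * Cβ * (complexity V m (1 / (2 * m)) / m)) ^ e + 1 / (2 * m) ≤
      2881 * Cρ * Cβ * V * ((m : ℝ) ^ (-e) * posLog m) := by
  have hV' : (1 : ℝ) ≤ V := by exact_mod_cast hV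
  have hm1 : (1 : ℝ) ≤ m := by exact_mod_cast Nat.one_le_iff_ne_zero.2 hm0
  have hm : (0 : ℝ) < m := by linarith
  have hl := one_le_posLog (m : ℝ)
  set l := posLog (m : ℝ) with hl_def
  have hΛ : complexity V m (1 / (2 * m)) ≤ 3 * V * l := by
    have h1 : posLog ((m : ℝ) / V) ≤ l := posLog_mono (by positivity) (div_le_self hm.le hV')
    have h2 : posLog (1 / (1 / (2 * (m : ℝ)))) ≤ 2 * l := by
      rw [one_div_one_div, posLog, Real.log_mul (by norm_num) hm.ne']
      have h3 : Real.log m ≤ l := le_max_left _ _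
      exact max_le (by linarith [log_two_le_one]) (by linarith)
    unfold complexity
    nlinarith [mul_le_mul_of_nonneg_left h1 (by linarith : (0 : ℝ) ≤ V)]
  have hΛ0 : 0 ≤ complexity V m (1 / (2 * m)) := by
    linarith [one_le_complexity V m (1 / (2 * m))]
  have hme : 0 < (m : ℝ) ^ (-e) := Real.rpow_pos_of_pos hm _
  have hbase : (1 : ℝ) ≤ 960 * Cβ * (3 * V * l) := by
    have : 1 ≤ V * l := one_le_mul_of_one_le_of_one_le hV' hl
    nlinarith
  have h1 : (960 * Cβ * (complexity V m (1 / (2 * m)) / m)) ^ e ≤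
      2880 * Cβ * V * l * (m : ℝ) ^ (-e) := by
    calc (960 * Cβ * (complexity V m (1 / (2 * m)) / m)) ^ e
        ≤ (960 * Cβ * (3 * V * l) / m) ^ e := by
          refine Real.rpow_le_rpow (by positivity) ?_ he0
          rw [← mul_div_assoc]
          gcongr
      _ = (960 * Cβ * (3 * V * l)) ^ e * (m : ℝ) ^ (-e) := by
          rw [Real.div_rpow (by linarith) hm.le, Real.rpow_neg hm.le, div_eq_mul_inv]
      _ ≤ (960 * Cβ * (3 * V * l)) ^ (1 : ℝ) * (m : ℝ) ^ (-e) := by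
          gcongr
      _ = _ := by rw [Real.rpow_one]; ring
  have h2 : 1 / (2 * (m : ℝ)) ≤ (m : ℝ) ^ (-e) := by
    calc 1 / (2 * (m : ℝ)) ≤ 1 / m := by
          apply one_div_le_one_div_of_le hm; linarith
      _ = (m : ℝ) ^ (-1 : ℝ) := by rw [Real.rpow_neg_one, one_div]
      _ ≤ _ := Real.rpow_le_rpow_of_exponent_le hm1 (by linarith)
  have h3 : (1 : ℝ) ≤ Cρ * Cβ * V * l := by
    have a1 : 1 ≤ Cρ * Cβ := by nlinarith
    have a2 : 1 ≤ V * l := one_le_mul_of_one_le_of_one_le hV' hl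
    calc (1 : ℝ) ≤ (Cρ * Cβ) * (V * l) := one_le_mul_of_one_le_of_one_le a1 a2
      _ = _ := by ring
  calc _ ≤ Cρ * (2880 * Cβ * V * l * (m : ℝ) ^ (-e)) + (Cρ * Cβ * V * l) * (m : ℝ) ^ (-e) := by
        refine add_le_add (mul_le_mul_of_nonneg_left h1 (by linarith)) (h2.trans ?_)
        exact le_mul_of_one_le_left hme.le h3
    _ = _ := by ring

theorem minimaxRisk_le (hH : ∀ h ∈ H, Measurable h) {V : ℕ} (hV : HasVCDim H V) (hV0 : 0 < V)
    (hE : AdmitsMeasurableERM H) (M : Params N) (σ : Equiv.Perm (Fin (N + 1)))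
    (hρ : ∀ t, 1 ≤ M.ρ t) :
    M.minimaxRisk H ≤
      ENNReal.ofReal (2881 * M.Cρ * M.Cβ * V) * ⨅ t, M.minimaxUpperTerm σ t := by
  have hCβ := M.two_le_Cβ
  have hCρ := M.two_le_Cρ
  have hV' : (0 : ℝ) < V := by exact_mod_cast hV0
  have hpos : 0 < 2881 * M.Cρ * M.Cβ * V := by positivity
  obtain ⟨t, ht⟩ := exists_eq_ciInf_of_finite (f := fun t => M.minimaxUpperTerm σ t)
  rw [← ht, Params.minimaxUpperTerm, orTop]
  split_ifs with hm
  · rw [ENNReal.mul_top (ENNReal.ofReal_pos.2 hpos).ne']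
    exact le_top
  obtain ⟨A, hAm, hA⟩ := exists_measurable_isERM hE M.n (Params.prefixSet σ t)
  unfold Params.minimaxRisk
  refine (iInf_le _ (⟨A, hA.1, hAm⟩ : {A : MultiSample X M.n → Classifier X //
    IsLearner H A ∧ MeasurableLearner A})).trans (iSup_le fun ⟨P, hP⟩ => ?_)
  have := hP.prob
  obtain ⟨hs, hbest⟩ := hP.common_best
  have : IsProbabilityMeasure (sampleLaw M.n P) := by unfold sampleLaw; infer_instance
  have hm' : (0 : ℝ) < M.prefixSize σ t := by exact_mod_cast Nat.pos_of_ne_zero hm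
  have hbad := prob_excessRisk_gt_le hH hV hV0 M σ hm
    (δ := 1 / (2 * M.prefixSize σ t)) (by positivity) hAm hA hP
  refine (lintegral_le_add_of_le_one (fun z => excessRisk_le_one (hbest (Fin.last N)))
    hbad).trans ?_
  have hΛ := one_le_complexity V (M.prefixSize σ t) (1 / (2 * M.prefixSize σ t))
  rw [← ENNReal.ofReal_add (mul_nonneg (by linarith) (Real.rpow_nonneg (by positivity) _))
    (by positivity), ← ENNReal.ofReal_mul hpos.le]
  exact ENNReal.ofReal_le_ofReal (rate_at_inv_two_mul_le hV0 hm hCρ hCβ (M.ratePower_nonneg t)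
    (M.ratePower_le_one hρ hm))

end MinimaxUpperBound

end Multisource

theorem theorem1 :
    ∃ c C c₁ c₂ C₀ : ℝ, 0 < c ∧ 0 < C ∧ 0 < c₁ ∧ 0 < c₂ ∧ 0 < C₀ ∧
      ∀ (X : Type u) [MeasurableSpace X] (H : Set (Multisource.Classifier X)) (V : ℕ),
        (∀ h ∈ H, Measurable h) → 3 ≤ H.encard → Multisource.HasVCDim H V →
        ∀ (N : ℕ) (M : Multisource.Params N) (σ : Equiv.Perm (Fin (N + 1))), M.IsRanking σ →
          -- minimax rate, up to constants and logarithmic factors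
          ((∀ t, 1 ≤ M.ρ t) → 0 < ∑ t, M.n t →
            ENNReal.ofReal c * (⨅ t, M.minimaxLowerTerm σ t) ≤ M.minimaxRisk H ∧
            (Multisource.AdmitsMeasurableERM H →
              M.minimaxRisk H ≤
                ENNReal.ofReal (C * M.Cρ * M.Cβ * V) * ⨅ t, M.minimaxUpperTerm σ t)) ∧
          -- lower bound, with probability at least 1/50, for every learner
          ((∀ t, 1 ≤ M.ρ t) →
            ∀ A : Multisource.MultiSample X M.n → Multisource.Classifier X,
              Multisource.IsLearner H A →
              ∃ P : Fin (N + 1) → Measure (X × Bool), M.Mem H P ∧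
                1 / 50 ≤ Multisource.sampleLaw M.n P
                  {z | ENNReal.ofReal c₁ * min 1 (⨅ t, M.lowerTerm c₂ V σ t) <
                    ENNReal.ofReal
                      (Multisource.excessRisk H (P (Fin.last N)) (A z))}) ∧
          -- upper bound, with probability at least 1 - δ, for the ERM on the best prefix
          (∀ δ : ℝ, 0 < δ → δ < 1 →
            ∀ tstar : Fin (N + 1),
              (∀ t, M.upperTerm C₀ V δ σ tstar ≤ M.upperTerm C₀ V δ σ t) →
              ∀ A : Multisource.MultiSample X M.n → Multisource.Classifier X,
                Multisource.MeasurableLearner A →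
                Multisource.IsERM H (Multisource.Params.prefixSet σ tstar) A →
                ∀ P : Fin (N + 1) → Measure (X × Bool), M.Mem H P →
                  ENNReal.ofReal (1 - δ) ≤ Multisource.sampleLaw M.n P
                    {z | ENNReal.ofReal
                        (Multisource.excessRisk H (P (Fin.last N)) (A z)) ≤
                      ⨅ t, M.upperTerm C₀ V δ σ t}) := by
  -- Origin of the constants: `c = c₁ / (50 · 4)`, `C = 3 C₀ + 1`, `c₁ = 1 / (4 · 50)` from the hard
  -- laws and Assouad's lemma, `c₂` from the information budget, `C₀ = 48 · 20`.
  refine ⟨1 / 40000, 2881, 1 / 200, 1 / 4, 960, by norm_num, by norm_num, by norm_num,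
    by norm_num, by norm_num, ?_⟩
  intro X _ H V hH hcard hV N M σ hσ
  have hV0 := Multisource.pos_of_hasVCDim hcard hV
  refine ⟨fun hρ hn => ⟨?_, fun hE => ?_⟩, fun hρ A hA => ?_, fun δ hδ _ t hmin A hAm hA P hP => ?_⟩
  · exact Multisource.le_minimaxRisk hH hcard hV M hσ hρ hn
  · exact Multisource.minimaxRisk_le hH hV hV0 hE M σ hρ
  · exact Multisource.exists_mem_lower_bound hH hcard hV M hσ hρ A hA
  · exact Multisource.le_prob_excessRisk_le hH hV hV0 M σ hδ hmin hAm hA hP
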